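/- Let $f(r)=\sum_{n\ge 0} r^n/(n!)^2$ for $r\in\mathbb R$, let $T>0$ and $y\in\mathbb R$, and let $(a_j)_{j\ge1}$ be a bounded sequence of real numbers with $\frac1N\sum_{j=1}^N a_j\to a$ as $N\to\infty$, where $a>0$. A Brownian sheet is a centred Gaussian process $B(t,x)$, $t,x\ge 0$, with almost surely continuous paths and covariance $E[B(t,x)B(t',x')]=\min(t,t')\min(x,x')$. For every $N\ge1$ let $(B^{1,N},\dots,B^{N,N})$ be an $N$-dimensional Brownian sheet (that is, $N$ independent Brownian sheets) on some probability space, and let $Y^{1,N},\dots,Y^{N,N}$ be measurable processes on $[0,T]^2$ with almost surely integrable paths that solve the linear $N$-particle system $$Y^{i,N}(t,x)=y+\int_0^t\!\!\int_0^x\Big(\frac1N\sum_{j=1}^N a_jY^{j,N}(u,v)-Y^{i,N}(u,v)\Big)\,dv\,du+B^{i,N}(t,x),\qquad 1\le i\le N,$$ almost surely for each $(t,x)\in[0,T]^2$. Let $B$ be a Brownian sheet on a further probability space. Then for every $i\ge1$ and every $(t,x)\in[0,T]^2$, as $N\to\infty$, $$Y^{i,N}(t,x)\ \xrightarrow{\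 d\ }\ Y(t,x):=f\big((a-1)tx\big)\,y+\int_0^t\!\!\int_0^x f\big(-(t-u)(x-v)\big)\,dB(u,v),$$ where the last integral is the Wiener–Itô integral of a deterministic function with respect to $B$. Moreover, the process $Y$ consists of square-integrable random variables and has a version with almost surely continuous paths on $[0,T]^2$ that solves the mean-field equation: almost surely, for all $(t,x)\in[0,T]^2$, $$Y(t,x)=y+\int_0^t\!\!\int_0^x\big(a\,E[Y(u,v)]-Y(u,v)\big)\,dv\,du+B(t,x).$$ -/

import Mathlib

open MeasureTheory ProbabilityTheory Filter Topology

noncomputable section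

/-- The Bessel-type function `f(y) = ∑ₙ yⁿ / (n!)²`. -/
def besselF (y : ℝ) : ℝ := ∑' n : ℕ, y ^ n / ((n.factorial : ℝ)) ^ 2

/-- `B` is a (standard, one-dimensional) Brownian sheet on the quadrant `[0,∞)²`: a centred
Gaussian process with covariance `min(t,t') * min(x,x')` and almost surely continuous paths.
Values of `B` outside the quadrant are irrelevant. -/
structure IsBrownianSheet {Ω : Type*} [MeasurableSpace Ω] (P : Measure Ω)
    (B : ℝ × ℝ → Ω → ℝ) : Prop where
  gaussian : IsGaussianProcess (fun z : Set.Ici (0 : ℝ × ℝ) => B z) P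
  mean : ∀ z : ℝ × ℝ, 0 ≤ z → ∫ ω, B z ω ∂P = 0
  covariance : ∀ z w : ℝ × ℝ, 0 ≤ z → 0 ≤ w →
    ∫ ω, B z ω * B w ω ∂P = min z.1 w.1 * min z.2 w.2
  continuous_paths : ∀ᵐ ω ∂P, ContinuousOn (fun z => B z ω) (Set.Ici 0)

/-- An `N`-dimensional Brownian sheet: `N` independent Brownian sheets. -/
structure IsMultiBrownianSheet {Ω : Type*} [MeasurableSpace Ω] (P : Measure Ω) {N : ℕ}
    (B : Fin N → ℝ × ℝ → Ω → ℝ) : Prop where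
  sheet : ∀ i, IsBrownianSheet P (B i)
  indep : iIndepFun (fun (i : Fin N) (ω : Ω) (z : Set.Ici (0 : ℝ × ℝ)) => B i z ω) P

/-- The step function `∑_w c(w) 1_{[0,w]}`. Indicators of arbitrary rectangles `(s,t] × (v,x]` in
the quadrant are linear combinations of the `1_{[0,w]}`, almost everywhere. -/
def stepFun (c : ℝ × ℝ →₀ ℝ) (ζ : ℝ × ℝ) : ℝ :=
  c.sum fun w r => (Set.Icc 0 w).indicator (fun _ => r) ζ

/-- The stochastic integral `∑_w c(w) B(w)` of the step function `∑_w c(w) 1_{[0,w]}`. -/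
def stepIntegral {Ω : Type*} (B : ℝ × ℝ → Ω → ℝ) (c : ℝ × ℝ →₀ ℝ) (ω : Ω) : ℝ :=
  c.sum fun w r => r * B w ω

/-- `I` is (a version of) the stochastic integral `∫ φ dB` over the quadrant of the deterministic
square-integrable function `φ`: the `L²(P)`-limit of the integrals of step functions that converge
to `φ` in `L²`. By the Itô isometry, `I` is determined by `φ` up to almost sure equality. -/
def IsWienerIntegral {Ω : Type*} [MeasurableSpace Ω] (P : Measure Ω) (B : ℝ × ℝ → Ω → ℝ)
    (φ : ℝ × ℝ → ℝ) (I : Ω → ℝ) : Prop :=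
  MemLp φ 2 (volume.restrict (Set.Ici 0)) ∧ MemLp I 2 P ∧
    ∃ c : ℕ → (ℝ × ℝ →₀ ℝ),
      (∀ n, ∀ w ∈ (c n).support, 0 ≤ w) ∧
      Tendsto (fun n => eLpNorm (fun ζ => stepFun (c n) ζ - φ ζ) 2
        (volume.restrict (Set.Ici 0))) atTop (𝓝 0) ∧
      Tendsto (fun n => eLpNorm (fun ω => stepIntegral B (c n) ω - I ω) 2 P) atTop (𝓝 0)

/-- `Y = (Y⁰, …, Y^{N-1})` solves, on `[0,T]²`, the linear `N`-particle system
`Yⁱ(z) = y + ∫_{[0,z]} ((1/N) ∑ⱼ aⱼ Yʲ(ζ) - Yⁱ(ζ)) dζ + Bⁱ(z)`. -/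
structure IsParticleSystem {Ω : Type*} [MeasurableSpace Ω] (P : Measure Ω) (T y : ℝ)
    (a : ℕ → ℝ) {N : ℕ} (B Y : Fin N → ℝ × ℝ → Ω → ℝ) : Prop where
  measurable : ∀ i, AEStronglyMeasurable (fun p : (ℝ × ℝ) × Ω => Y i p.1 p.2)
    ((volume.restrict (Set.Icc 0 (T, T))).prod P)
  integrable_paths : ∀ i, ∀ᵐ ω ∂P, IntegrableOn (fun ζ => Y i ζ ω) (Set.Icc 0 (T, T))
  equation : ∀ i, ∀ z ∈ Set.Icc (0 : ℝ × ℝ) (T, T), ∀ᵐ ω ∂P,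
    Y i z ω = y + (∫ ζ in Set.Icc 0 z, ((1 / (N : ℝ)) * ∑ j : Fin N, a j * Y j ζ ω - Y i ζ ω))
      + B i z ω

/-- `Y` solves, on `[0,T]²`, the mean-field equation
`Y(z) = y + ∫_{[0,z]} (α E[Y(ζ)] - Y(ζ)) dζ + B(z)`. -/
structure IsMeanFieldSolution {Ω : Type*} [MeasurableSpace Ω] (P : Measure Ω) (T y α : ℝ)
    (B Y : ℝ × ℝ → Ω → ℝ) : Prop where
  measurable : AEStronglyMeasurable (fun p : (ℝ × ℝ) × Ω => Y p.1 p.2)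
    ((volume.restrict (Set.Icc 0 (T, T))).prod P)
  memLp : ∀ z ∈ Set.Icc (0 : ℝ × ℝ) (T, T), MemLp (Y z) 2 P
  continuous_paths : ∀ᵐ ω ∂P, ContinuousOn (fun z => Y z ω) (Set.Icc 0 (T, T))
  integrable_mean : IntegrableOn (fun ζ => ∫ ω, Y ζ ω ∂P) (Set.Icc 0 (T, T))
  equation : ∀ᵐ ω ∂P, ∀ z ∈ Set.Icc (0 : ℝ × ℝ) (T, T),
    Y z ω = y + (∫ ζ in Set.Icc 0 z, (α * (∫ ω', Y ζ ω' ∂P) - Y ζ ω)) + B z ω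

end

/-!
Write `J g (z) = ∫_{[0,z]} g` and `f = besselF`. Integrating the power series term by term gives
`f(c t x) = 1 + c J[f(c · ·)](t, x)` (`besselF_eq_one_add_integral`), so `f` solves the linear Goursat
problem. By Fubini, the operator `1 + J` is inverted by
`R b (z) = b(z) - ∫_{[0,z]} f(-(z₁ - ζ₁)(z₂ - ζ₂)) b(ζ) dζ` (`goursatResolvent_eq`), and applied path by
path to a Brownian sheet `B` it yields the limit `Y(t, x) = f((α - 1) t x) y + (R B)(t, x)`.
Inserting this into the mean-field equation is then algebra, once `E[R B] = 0` is known.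

`R B(z)` is a Wiener integral. The identity
`1_{[0,z]}(ζ) f(-(z₁ - ζ₁)(z₂ - ζ₂)) = 1_{[0,z]}(ζ) - ∫_{[0,z]} f(-(z₁ - w₁)(z₂ - w₂)) 1_{[0,w]}(ζ) dw`
(`goursatResolvent_indicator`) writes the integrand as a superposition of the indicators `1_{[0,w]}`.
The same Riemann sums of the two `dw`-integrals, for the integrand and for `R B(z)`, give step functions
that converge to the integrand in `L²`, and step integrals that converge to `R B(z)` almost surely. By
the isometry the step integrals are Cauchy in `L²`, so they also converge to `R B(z)` in `L²`. They are
Gaussian with laws that do not depend on the sheet, hence neither does the law of `R B(z)`.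

For the particle system, each particle is replaced by its version with continuous paths, which almost
surely solves the system in all points at once. Let `ā` be the average of the coefficients and
`β = N⁻¹ ∑ aⱼ Bʲ` the averaged noise. The empirical mean minus `ā f((ā - 1) t x) y` solves
`m = J((ā - 1) m) + β`, and `D = Yⁱ - f((ā - 1) t x) y - R Bⁱ` solves `D = J(m - D)`. Two applications
of a Gronwall inequality on rectangles bound `D`, path by path, by a constant times `∫ |β|`
(`abs_particle_sub_le`), and `E ∫ |β| = O(N^{-1/2})` by independence. Since `R Bⁱ(z)` has the law of
`R B(z)`, this `L¹`-bound yields the convergence in distribution.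
-/

/-! ### The Bessel-type function -/

lemma abs_besselTerm_le {y R : ℝ} (hy : |y| ≤ R) (n : ℕ) :
    ‖y ^ n / ((n.factorial : ℝ)) ^ 2‖ ≤ R ^ n / n.factorial := by
  have h1 : (1 : ℝ) ≤ n.factorial := by exact_mod_cast n.factorial_pos
  rw [Real.norm_eq_abs, abs_div, abs_pow,
    abs_of_nonneg (by positivity : (0 : ℝ) ≤ (n.factorial : ℝ) ^ 2)]
  have hR : 0 ≤ R := (abs_nonneg y).trans hy
  gcongr
  nlinarith

lemma continuous_besselF : Continuous besselF := by
  refine continuous_iff_continuousAt.2 fun y => ?_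
  have h : ContinuousOn besselF (Metric.ball 0 (|y| + 1)) := by
    refine continuousOn_tsum (u := fun n : ℕ => (|y| + 1) ^ n / n.factorial) (fun n => by fun_prop)
      (Real.summable_pow_div_factorial _) fun n x hx => abs_besselTerm_le ?_ n
    simpa using (mem_ball_zero_iff.1 hx).le
  exact h.continuousAt (Metric.isOpen_ball.mem_nhds (by simp))

@[fun_prop]
lemma Continuous.besselF {X : Type*} [TopologicalSpace X] {g : X → ℝ} (hg : Continuous g) :
    Continuous fun x => besselF (g x) :=
  continuous_besselF.comp hg

lemma abs_besselF_le (y : ℝ) : |besselF y| ≤ Real.exp |y| := by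
  rw [Real.exp_eq_exp_ℝ, NormedSpace.exp_eq_tsum_div]
  exact tsum_of_norm_bounded (Real.summable_pow_div_factorial _).hasSum
    fun n => abs_besselTerm_le le_rfl n

lemma Icc_zero_prod (s : ℝ × ℝ) : Set.Icc 0 s = Set.Icc 0 s.1 ×ˢ Set.Icc 0 s.2 :=
  Set.Icc_prod_eq 0 s

lemma setIntegral_rect_mul_pow {s : ℝ × ℝ} (hs : 0 ≤ s) (n : ℕ) :
    ∫ ζ in Set.Icc 0 s, (ζ.1 * ζ.2) ^ n = (s.1 * s.2) ^ (n + 1) / ((n : ℝ) + 1) ^ 2 := by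
  have key : ∀ r : ℝ, 0 ≤ r → ∫ x in Set.Icc 0 r, x ^ n = r ^ (n + 1) / ((n : ℝ) + 1) := by
    intro r hr
    rw [integral_Icc_eq_integral_Ioc, ← intervalIntegral.integral_of_le hr, integral_pow]
    simp
  simp_rw [mul_pow, Icc_zero_prod]
  rw [Measure.volume_eq_prod, setIntegral_prod_mul (fun x : ℝ => x ^ n) (fun x : ℝ => x ^ n),
    key _ hs.1, key _ hs.2, div_mul_div_comm, ← mul_pow, ← sq]

/-- The function `s ↦ besselF (c s₁ s₂)` solves the linear Goursat problem `g = 1 + c ∫_{[0,·]} g`. -/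
lemma besselF_eq_one_add_integral (c : ℝ) {s : ℝ × ℝ} (hs : 0 ≤ s) :
    besselF (c * (s.1 * s.2)) = 1 + c * ∫ ζ in Set.Icc 0 s, besselF (c * (ζ.1 * ζ.2)) := by
  have hfin : volume (Set.Icc 0 s) < ⊤ := isCompact_Icc.measure_lt_top
  set R := |c| * (s.1 * s.2)
  have hbound : ∀ n : ℕ, ∀ ζ ∈ Set.Icc 0 s,
      ‖(c * (ζ.1 * ζ.2)) ^ n / ((n.factorial : ℝ)) ^ 2‖ ≤ R ^ n / n.factorial := by
    intro n ζ hζ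
    refine abs_besselTerm_le ?_ n
    rw [abs_mul, abs_of_nonneg (mul_nonneg hζ.1.1 hζ.1.2)]
    exact mul_le_mul_of_nonneg_left
      (mul_le_mul hζ.2.1 hζ.2.2 hζ.1.2 hs.1) (abs_nonneg c)
  have hint : ∀ n : ℕ, IntegrableOn
      (fun ζ : ℝ × ℝ => (c * (ζ.1 * ζ.2)) ^ n / ((n.factorial : ℝ)) ^ 2) (Set.Icc 0 s) :=
    fun n => ContinuousOn.integrableOn_compact isCompact_Icc (by fun_prop)
  have hsum : ∫ ζ in Set.Icc 0 s, besselF (c * (ζ.1 * ζ.2))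
      = ∑' n : ℕ, c ^ n * (s.1 * s.2) ^ (n + 1) / (((n + 1).factorial : ℝ)) ^ 2 := by
    have h1 := integral_tsum_of_summable_integral_norm (μ := volume.restrict (Set.Icc 0 s)) hint ?_
    · simp only [besselF]
      rw [← h1]
      congr 1 with n
      have hterm : ∀ ζ : ℝ × ℝ, (c * (ζ.1 * ζ.2)) ^ n / ((n.factorial : ℝ)) ^ 2
          = c ^ n / ((n.factorial : ℝ)) ^ 2 * (ζ.1 * ζ.2) ^ n := fun ζ => by
        rw [mul_pow, div_mul_eq_mul_div]
      simp_rw [hterm]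
      rw [integral_const_mul, setIntegral_rect_mul_pow hs, Nat.factorial_succ]
      push_cast
      have : (n.factorial : ℝ) ≠ 0 := by positivity
      have : (n : ℝ) + 1 ≠ 0 := by positivity
      field_simp
    · refine Summable.of_nonneg_of_le (fun n => by positivity) (fun n => ?_)
        ((Real.summable_pow_div_factorial R).mul_right (volume.real (Set.Icc 0 s)))
      refine (setIntegral_mono_on (hint n).norm (integrableOn_const hfin.ne) measurableSet_Icc
        (hbound n)).trans_eq ?_
      rw [setIntegral_const, smul_eq_mul, mul_comm]
  rw [hsum, besselF, (Summable.of_norm_bounded (Real.summable_pow_div_factorial _)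
    fun n => abs_besselTerm_le le_rfl n).tsum_eq_zero_add, ← tsum_mul_left]
  congr 1
  · simp
  · congr 1 with n
    rw [mul_pow]
    ring

/-! ### Integrals over rectangles with a corner at the origin -/

lemma ae_fst_ne_and_snd_ne (z : ℝ × ℝ) : ∀ᵐ ζ : ℝ × ℝ, ζ.1 ≠ z.1 ∧ ζ.2 ≠ z.2 := by
  have h1 : ∀ᵐ x : ℝ, x ≠ z.1 := compl_mem_ae_iff.2 (measure_singleton _)
  have h2 : ∀ᵐ x : ℝ, x ≠ z.2 := compl_mem_ae_iff.2 (measure_singleton _)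
  exact (Measure.quasiMeasurePreserving_fst.ae h1).and (Measure.quasiMeasurePreserving_snd.ae h2)

lemma eventually_mem_Icc_zero_iff {ζ z₀ : ℝ × ℝ} (h1 : ζ.1 ≠ z₀.1) (h2 : ζ.2 ≠ z₀.2) :
    ∀ᶠ z in 𝓝 z₀, (ζ ∈ Set.Icc 0 z ↔ ζ ∈ Set.Icc 0 z₀) := by
  have key : ∀ {x r : ℝ}, x ≠ r → ∀ᶠ t in 𝓝 r, (x ≤ t ↔ x ≤ r) := by
    intro x r h
    rcases h.lt_or_gt with h | h
    · filter_upwards [lt_mem_nhds h] with t ht using ⟨fun _ => h.le, fun _ => ht.le⟩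
    · filter_upwards [gt_mem_nhds h] with t ht
      exact ⟨fun h' => absurd h' (not_le.2 ht), fun h' => absurd h' (not_le.2 h)⟩
  filter_upwards [continuous_fst.continuousAt.eventually (key h1),
    continuous_snd.continuousAt.eventually (key h2)] with z hz1 hz2
  simp only [Set.mem_Icc, Prod.le_def] at *
  rw [hz1, hz2]

lemma continuousOn_setIntegral_Icc_zero {g : ℝ × ℝ → ℝ} {S : ℝ × ℝ}
    (hg : IntegrableOn g (Set.Icc 0 S)) :
    ContinuousOn (fun z => ∫ ζ in Set.Icc 0 z, g ζ) (Set.Icc 0 S) := by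
  have heq : ∀ z ∈ Set.Icc 0 S, ∫ ζ in Set.Icc 0 z, g ζ
      = ∫ ζ in Set.Icc 0 S, (Set.Icc 0 z).indicator g ζ := by
    intro z hz
    rw [setIntegral_indicator measurableSet_Icc,
      Set.inter_eq_right.2 (Set.Icc_subset_Icc_right hz.2)]
  refine ContinuousOn.congr (fun z₀ hz₀ => ?_) heq
  refine tendsto_integral_filter_of_dominated_convergence (fun ζ => ‖g ζ‖) ?_ ?_ hg.norm ?_
  · exact Eventually.of_forall fun z => hg.aestronglyMeasurable.indicator measurableSet_Icc
  · exact Eventually.of_forall fun z => ae_of_all _ fun ζ => norm_indicator_le_norm_self g ζ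
  · filter_upwards [ae_restrict_of_ae (ae_fst_ne_and_snd_ne z₀)] with ζ hζ
    refine (tendsto_const_nhds (x := (Set.Icc 0 z₀).indicator g ζ)).congr' ?_
    filter_upwards [nhdsWithin_le_nhds (eventually_mem_Icc_zero_iff hζ.1 hζ.2)] with z hz
    by_cases h : ζ ∈ Set.Icc 0 z₀
    · rw [Set.indicator_of_mem h, Set.indicator_of_mem (hz.2 h)]
    · rw [Set.indicator_of_notMem h, Set.indicator_of_notMem (fun h' => h (hz.1 h'))]

lemma setIntegral_Icc_exp_le {r : ℝ} (hr : 0 < r) (s : ℝ × ℝ) (hs : 0 ≤ s) :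
    ∫ ζ in Set.Icc 0 s, Real.exp (r * (ζ.1 + ζ.2)) ≤ Real.exp (r * (s.1 + s.2)) / r ^ 2 := by
  have key : ∀ t : ℝ, 0 ≤ t → ∫ x in Set.Icc 0 t, Real.exp (r * x) = (Real.exp (r * t) - 1) / r := by
    intro t ht
    rw [integral_Icc_eq_integral_Ioc, ← intervalIntegral.integral_of_le ht,
      intervalIntegral.integral_comp_mul_left (fun x => Real.exp x) hr.ne', integral_exp]
    simp [div_eq_inv_mul]
  simp_rw [mul_add, Real.exp_add, Icc_zero_prod]
  rw [Measure.volume_eq_prod, setIntegral_prod_mul (fun x : ℝ => Real.exp (r * x))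
    (fun x : ℝ => Real.exp (r * x)), key _ hs.1, key _ hs.2, div_mul_div_comm, ← sq]
  have h1 : 1 ≤ Real.exp (r * s.1) := Real.one_le_exp (mul_nonneg hr.le hs.1)
  have h2 : 1 ≤ Real.exp (r * s.2) := Real.one_le_exp (mul_nonneg hr.le hs.2)
  refine div_le_div_of_nonneg_right ?_ (by positivity)
  nlinarith

/-- A Gronwall inequality on rectangles, with a constant that depends on `L` and the rectangle only. -/
lemma gronwall_rect {φ : ℝ × ℝ → ℝ} {S : ℝ × ℝ} {H L : ℝ} (hH : 0 ≤ H) (hL : 0 ≤ L)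
    (hφ : ContinuousOn φ (Set.Icc 0 S)) (hφ0 : ∀ z ∈ Set.Icc 0 S, 0 ≤ φ z)
    (h : ∀ z ∈ Set.Icc 0 S, φ z ≤ H + L * ∫ ζ in Set.Icc 0 z, φ ζ) {z : ℝ × ℝ}
    (hz : z ∈ Set.Icc 0 S) :
    φ z ≤ 2 * Real.exp ((2 * L + 1) * (S.1 + S.2)) * H := by
  set r := 2 * L + 1 with hr_def
  have hr : 0 < r := by positivity
  -- the maximum of `φ` relative to the weight `exp (r (ζ₁ + ζ₂))`; the choice of `r` makes
  -- integration a contraction by the factor `1/2` for the weighted norm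
  obtain ⟨w, hw, hmax⟩ := isCompact_Icc.exists_isMaxOn ⟨z, hz⟩
    (f := fun ζ => φ ζ * Real.exp (-(r * (ζ.1 + ζ.2)))) (by fun_prop)
  set m := φ w * Real.exp (-(r * (w.1 + w.2))) with hm
  have hm0 : 0 ≤ m := mul_nonneg (hφ0 w hw) (Real.exp_pos _).le
  have hle : ∀ ζ ∈ Set.Icc 0 S, φ ζ ≤ m * Real.exp (r * (ζ.1 + ζ.2)) := by
    intro ζ hζ
    have : φ ζ * Real.exp (-(r * (ζ.1 + ζ.2))) ≤ m := hmax hζ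
    rwa [Real.exp_neg, ← div_eq_mul_inv, div_le_iff₀ (Real.exp_pos _)] at this
  have hweq : φ w = m * Real.exp (r * (w.1 + w.2)) := by
    rw [hm, mul_assoc, ← Real.exp_add]; simp
  have hsub : Set.Icc 0 w ⊆ Set.Icc 0 S := Set.Icc_subset_Icc_right hw.2
  have hI : ∫ ζ in Set.Icc 0 w, φ ζ ≤ m * (Real.exp (r * (w.1 + w.2)) / r ^ 2) := by
    calc ∫ ζ in Set.Icc 0 w, φ ζ ≤ ∫ ζ in Set.Icc 0 w, m * Real.exp (r * (ζ.1 + ζ.2)) :=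
          setIntegral_mono_on ((hφ.mono hsub).integrableOn_compact isCompact_Icc)
            (ContinuousOn.integrableOn_compact isCompact_Icc (by fun_prop)) measurableSet_Icc
            fun ζ hζ => hle ζ (hsub hζ)
      _ = m * ∫ ζ in Set.Icc 0 w, Real.exp (r * (ζ.1 + ζ.2)) := integral_const_mul _ _
      _ ≤ _ := mul_le_mul_of_nonneg_left (setIntegral_Icc_exp_le hr w hw.1) hm0
  have hE : 1 ≤ Real.exp (r * (w.1 + w.2)) :=
    Real.one_le_exp (mul_nonneg hr.le (add_nonneg hw.1.1 hw.1.2))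
  have hcontr : L * (m * (Real.exp (r * (w.1 + w.2)) / r ^ 2))
      ≤ m * Real.exp (r * (w.1 + w.2)) / 2 := by
    have h2 : L / r ^ 2 ≤ 1 / 2 := by
      rw [div_le_div_iff₀ (by positivity) two_pos]; nlinarith
    have := mul_le_mul_of_nonneg_left h2 (mul_nonneg hm0 (Real.exp_pos (r * (w.1 + w.2))).le)
    calc _ = m * Real.exp (r * (w.1 + w.2)) * (L / r ^ 2) := by ring
      _ ≤ _ := this
      _ = _ := by ring
  have hw' := h w hw
  have hm2 : m ≤ 2 * H := by
    have h3 : m * Real.exp (r * (w.1 + w.2)) ≤ 2 * H := by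
      have := mul_le_mul_of_nonneg_left hI hL
      linarith
    nlinarith
  calc φ z ≤ m * Real.exp (r * (z.1 + z.2)) := hle z hz
    _ ≤ (2 * H) * Real.exp (r * (S.1 + S.2)) := by
      have h1 := hz.2.1
      have h2 := hz.2.2
      gcongr
    _ = _ := by ring

/-! ### The resolvent of the Goursat problem -/

/-- Integrating the kernel `besselF (-((w₁ - ζ₁) (w₂ - ζ₂)))` over its upper variable `w`. -/
lemma setIntegral_kernel_left {z ζ : ℝ × ℝ} (h : ζ ≤ z) :
    ∫ w in Set.Icc ζ z, besselF (-((w.1 - ζ.1) * (w.2 - ζ.2)))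
      = 1 - besselF (-((z.1 - ζ.1) * (z.2 - ζ.2))) := by
  have h1 : ∫ w in Set.Icc ζ z, besselF (-((w.1 - ζ.1) * (w.2 - ζ.2)))
      = ∫ s in Set.Icc 0 (z - ζ), besselF (-1 * (s.1 * s.2)) := by
    rw [← integral_indicator measurableSet_Icc, ← integral_indicator measurableSet_Icc,
      ← integral_sub_right_eq_self (Set.indicator (Set.Icc 0 (z - ζ)) _) ζ]
    congr 1 with w
    have : w ∈ Set.Icc ζ z ↔ w - ζ ∈ Set.Icc 0 (z - ζ) := by simp
    by_cases hw : w ∈ Set.Icc ζ z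
    · rw [Set.indicator_of_mem hw, Set.indicator_of_mem (this.1 hw)]; simp
    · rw [Set.indicator_of_notMem hw, Set.indicator_of_notMem (fun h' => hw (this.2 h'))]
  have h2 := besselF_eq_one_add_integral (-1) (sub_nonneg.2 h)
  rw [h1]
  simp only [Prod.fst_sub, Prod.snd_sub] at h2
  rw [← neg_one_mul ((z.1 - ζ.1) * (z.2 - ζ.2)), h2]
  ring

/-- Integrating the kernel `besselF (-((z₁ - w₁) (z₂ - w₂)))` over its lower variable `w`. -/
lemma setIntegral_kernel_right {z ζ : ℝ × ℝ} (h : ζ ≤ z) :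
    ∫ w in Set.Icc ζ z, besselF (-((z.1 - w.1) * (z.2 - w.2)))
      = 1 - besselF (-((z.1 - ζ.1) * (z.2 - ζ.2))) := by
  rw [← setIntegral_kernel_left h, ← integral_indicator measurableSet_Icc,
    ← integral_indicator measurableSet_Icc,
    ← integral_sub_left_eq_self (Set.indicator (Set.Icc ζ z) _) volume (z + ζ)]
  congr 1 with w
  have : w ∈ Set.Icc ζ z ↔ z + ζ - w ∈ Set.Icc ζ z := by
    rw [Set.mem_Icc, Set.mem_Icc, le_sub_comm, add_sub_cancel_right, sub_le_comm,
      add_sub_cancel_left]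
    tauto
  by_cases hw : w ∈ Set.Icc ζ z
  · rw [Set.indicator_of_mem hw, Set.indicator_of_mem (this.1 hw)]
    simp only [Prod.fst_sub, Prod.snd_sub, Prod.fst_add, Prod.snd_add]
    congr 2
    ring
  · rw [Set.indicator_of_notMem hw, Set.indicator_of_notMem (fun h' => hw (this.2 h'))]

/-- The operator inverse to `V ↦ V + ∫_{[0,·]} V`, written with its Bessel-type kernel. -/
noncomputable def goursatResolvent (b : ℝ × ℝ → ℝ) (z : ℝ × ℝ) : ℝ :=
  b z - ∫ ζ in Set.Icc 0 z, besselF (-((z.1 - ζ.1) * (z.2 - ζ.2))) * b ζ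

lemma abs_kernel_le {S z ζ : ℝ × ℝ} (hz : z ∈ Set.Icc 0 S) (hζ : ζ ∈ Set.Icc 0 z) :
    |besselF (-((z.1 - ζ.1) * (z.2 - ζ.2)))| ≤ Real.exp (S.1 * S.2) := by
  refine (abs_besselF_le _).trans (Real.exp_le_exp.2 ?_)
  have h1 := hz.2.1
  have h2 := hz.2.2
  have h3 := hζ.1.1
  have h4 := hζ.1.2
  have h5 : 0 ≤ z.1 - ζ.1 := sub_nonneg.2 hζ.2.1
  have h6 : 0 ≤ z.2 - ζ.2 := sub_nonneg.2 hζ.2.2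
  simp only [Prod.fst_zero, Prod.snd_zero] at h3 h4
  rw [abs_neg, abs_of_nonneg (mul_nonneg h5 h6)]
  exact mul_le_mul (by linarith) (by linarith) h6 (by linarith)

open Classical in
/-- The kernel of `goursatResolvent` at the points `(w, ζ)`, extended by zero outside `ζ ≤ w`. -/
noncomputable def goursatKernel (p : (ℝ × ℝ) × (ℝ × ℝ)) : ℝ :=
  if p.2 ≤ p.1 then besselF (-((p.1.1 - p.2.1) * (p.1.2 - p.2.2))) else 0

lemma goursatKernel_of_le {w ζ : ℝ × ℝ} (h : ζ ≤ w) :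
    goursatKernel (w, ζ) = besselF (-((w.1 - ζ.1) * (w.2 - ζ.2))) := if_pos h

lemma goursatKernel_of_not_le {w ζ : ℝ × ℝ} (h : ¬ ζ ≤ w) : goursatKernel (w, ζ) = 0 := if_neg h

lemma measurable_goursatKernel : Measurable goursatKernel :=
  Measurable.ite (measurableSet_le measurable_snd measurable_fst)
    (Continuous.measurable (by fun_prop)) measurable_const

lemma isFiniteMeasure_restrict_rect (z : ℝ × ℝ) :
    IsFiniteMeasure (volume.restrict (Set.Icc 0 z)) :=
  isFiniteMeasure_restrict.2 isCompact_Icc.measure_lt_top.ne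

lemma integrable_goursatKernel_mul {b : ℝ × ℝ → ℝ} {z : ℝ × ℝ}
    (hb : IntegrableOn b (Set.Icc 0 z)) :
    Integrable (fun p : (ℝ × ℝ) × (ℝ × ℝ) => goursatKernel p * b p.2)
      ((volume.restrict (Set.Icc 0 z)).prod (volume.restrict (Set.Icc 0 z))) := by
  have := isFiniteMeasure_restrict_rect z
  refine Integrable.mono' (g := fun p => Real.exp (z.1 * z.2) * ‖b p.2‖)
    ((hb.norm.comp_snd _).const_mul _)
    (measurable_goursatKernel.aestronglyMeasurable.mul hb.aestronglyMeasurable.comp_snd) ?_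
  rw [Measure.prod_restrict]
  filter_upwards [ae_restrict_mem (measurableSet_Icc.prod measurableSet_Icc)] with ⟨w, ζ⟩ hp
  rw [norm_mul]
  refine mul_le_mul_of_nonneg_right ?_ (norm_nonneg _)
  by_cases h : ζ ≤ w
  · rw [goursatKernel_of_le h]
    exact abs_kernel_le hp.1 ⟨hp.2.1, h⟩
  · rw [goursatKernel_of_not_le h, norm_zero]
    positivity

lemma setIntegral_goursatKernel_mul {b : ℝ × ℝ → ℝ} {z w : ℝ × ℝ} (hw : w ∈ Set.Icc 0 z) :
    ∫ ζ in Set.Icc 0 z, goursatKernel (w, ζ) * b ζ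
    = ∫ ζ in Set.Icc 0 w, besselF (-((w.1 - ζ.1) * (w.2 - ζ.2))) * b ζ := by
  rw [setIntegral_eq_of_subset_of_forall_sdiff_eq_zero measurableSet_Icc
    (Set.Icc_subset_Icc_right hw.2) (f := fun ζ => goursatKernel (w, ζ) * b ζ) fun ζ hζ => ?_]
  · exact setIntegral_congr_fun measurableSet_Icc fun ζ hζ => by
      simp only [goursatKernel_of_le hζ.2]
  · rw [goursatKernel_of_not_le fun h => hζ.2 ⟨hζ.1.1, h⟩, zero_mul]

lemma setIntegral_goursatKernel_left {z ζ : ℝ × ℝ} (hζ : ζ ∈ Set.Icc 0 z) :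
    ∫ w in Set.Icc 0 z, goursatKernel (w, ζ) = 1 - besselF (-((z.1 - ζ.1) * (z.2 - ζ.2))) := by
  rw [← setIntegral_kernel_left hζ.2,
    setIntegral_eq_of_subset_of_forall_sdiff_eq_zero measurableSet_Icc
      (Set.Icc_subset_Icc_left hζ.1) (f := fun w => goursatKernel (w, ζ)) fun w hw => ?_]
  · exact setIntegral_congr_fun measurableSet_Icc fun w hw => goursatKernel_of_le hw.1
  · exact goursatKernel_of_not_le fun h => hw.2 ⟨h, hw.1.2⟩

lemma integrableOn_goursatResolvent {b : ℝ × ℝ → ℝ} {z : ℝ × ℝ}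
    (hb : IntegrableOn b (Set.Icc 0 z)) : IntegrableOn (goursatResolvent b) (Set.Icc 0 z) := by
  refine hb.sub ((integrable_goursatKernel_mul hb).integral_prod_left.congr ?_)
  filter_upwards [ae_restrict_mem measurableSet_Icc] with w hw
  exact setIntegral_goursatKernel_mul hw

/-- `V = goursatResolvent b` solves `V + ∫_{[0,·]} V = b`. -/
lemma goursatResolvent_eq {b : ℝ × ℝ → ℝ} {z : ℝ × ℝ} (hb : IntegrableOn b (Set.Icc 0 z)) :
    goursatResolvent b z = b z - ∫ ζ in Set.Icc 0 z, goursatResolvent b ζ := by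
  have hK := integrable_goursatKernel_mul hb
  -- after exchanging the integrals, the inner one is known from `setIntegral_kernel_left`
  have hswap : ∫ w in Set.Icc 0 z, ∫ ζ in Set.Icc 0 w, besselF (-((w.1 - ζ.1) * (w.2 - ζ.2))) * b ζ
      = ∫ ζ in Set.Icc 0 z, (1 - besselF (-((z.1 - ζ.1) * (z.2 - ζ.2)))) * b ζ := by
    rw [← setIntegral_congr_fun measurableSet_Icc fun w hw => setIntegral_goursatKernel_mul hw,
      integral_integral_swap hK]
    exact setIntegral_congr_fun measurableSet_Icc fun ζ hζ => by
      simp only [integral_mul_const, setIntegral_goursatKernel_left hζ]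
  have hKint : IntegrableOn (fun w => ∫ ζ in Set.Icc 0 w,
      besselF (-((w.1 - ζ.1) * (w.2 - ζ.2))) * b ζ) (Set.Icc 0 z) := by
    refine hK.integral_prod_left.congr ?_
    filter_upwards [ae_restrict_mem measurableSet_Icc] with w hw
    exact setIntegral_goursatKernel_mul hw
  have hkb : IntegrableOn (fun ζ => besselF (-((z.1 - ζ.1) * (z.2 - ζ.2))) * b ζ)
      (Set.Icc 0 z) :=
    hb.continuousOn_mul (by fun_prop) isCompact_Icc
  have hsub : ∫ ζ in Set.Icc 0 z, goursatResolvent b ζ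
      = (∫ ζ in Set.Icc 0 z, b ζ) - ∫ w in Set.Icc 0 z, ∫ ζ in Set.Icc 0 w,
        besselF (-((w.1 - ζ.1) * (w.2 - ζ.2))) * b ζ := integral_sub hb hKint
  rw [hsub, hswap]
  simp_rw [sub_mul (1 : ℝ), one_mul]
  rw [goursatResolvent, integral_sub hb hkb]
  ring

lemma continuousOn_goursatResolvent {b : ℝ × ℝ → ℝ} {S : ℝ × ℝ}
    (hb : ContinuousOn b (Set.Icc 0 S)) : ContinuousOn (goursatResolvent b) (Set.Icc 0 S) := by
  have hbi : IntegrableOn b (Set.Icc 0 S) := hb.integrableOn_compact isCompact_Icc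
  refine (hb.sub (continuousOn_setIntegral_Icc_zero (integrableOn_goursatResolvent hbi))).congr
    fun z hz => ?_
  exact goursatResolvent_eq (hbi.mono_set (Set.Icc_subset_Icc_right hz.2))

/-! ### Stability of the particle system along a path -/

lemma setIntegral_Icc_zero_mono {g : ℝ × ℝ → ℝ} {S z : ℝ × ℝ} (hz : z ∈ Set.Icc 0 S)
    (hg : IntegrableOn g (Set.Icc 0 S)) (hg0 : ∀ ζ, 0 ≤ g ζ) :
    ∫ ζ in Set.Icc 0 z, g ζ ≤ ∫ ζ in Set.Icc 0 S, g ζ :=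
  setIntegral_mono_set hg (ae_of_all _ hg0) (Set.Icc_subset_Icc_right hz.2).eventuallyLE

/-- A solution of `u = ∫_{[0,·]} (c u + h)` is controlled by the integral of `|h|`. -/
lemma abs_le_of_eq_setIntegral {u h : ℝ × ℝ → ℝ} {S : ℝ × ℝ} {c L : ℝ} (hc : |c| ≤ L)
    (hu : ContinuousOn u (Set.Icc 0 S)) (hh : ContinuousOn h (Set.Icc 0 S))
    (heq : ∀ z ∈ Set.Icc 0 S, u z = ∫ ζ in Set.Icc 0 z, (c * u ζ + h ζ)) {z : ℝ × ℝ}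
    (hz : z ∈ Set.Icc 0 S) :
    |u z| ≤ 2 * Real.exp ((2 * L + 1) * (S.1 + S.2)) * ∫ ζ in Set.Icc 0 S, |h ζ| := by
  have hL : 0 ≤ L := (abs_nonneg c).trans hc
  have hui : IntegrableOn (fun ζ => |u ζ|) (Set.Icc 0 S) :=
    hu.abs.integrableOn_compact isCompact_Icc
  have hhi : IntegrableOn (fun ζ => |h ζ|) (Set.Icc 0 S) :=
    hh.abs.integrableOn_compact isCompact_Icc
  refine gronwall_rect (φ := fun ζ => |u ζ|) (by positivity) hL hu.abs
    (fun _ _ => abs_nonneg _) (fun w hw => ?_) hz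
  have hsub : Set.Icc 0 w ⊆ Set.Icc 0 S := Set.Icc_subset_Icc_right hw.2
  calc |u w| = |∫ ζ in Set.Icc 0 w, (c * u ζ + h ζ)| := by rw [← heq w hw]
    _ ≤ ∫ ζ in Set.Icc 0 w, |c * u ζ + h ζ| := abs_integral_le_integral_abs
    _ ≤ ∫ ζ in Set.Icc 0 w, (|h ζ| + L * |u ζ|) := by
      refine integral_mono
        ((((hu.const_smul c).add hh).mono hsub).abs.integrableOn_compact isCompact_Icc)
        ((hhi.mono_set hsub).add ((hui.mono_set hsub).const_mul L)) fun ζ => ?_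
      have h1 := abs_add_le (c * u ζ) (h ζ)
      have h2 : |c| * |u ζ| ≤ L * |u ζ| := mul_le_mul_of_nonneg_right hc (abs_nonneg _)
      rw [abs_mul] at h1
      simp only
      linarith
    _ = (∫ ζ in Set.Icc 0 w, |h ζ|) + L * ∫ ζ in Set.Icc 0 w, |u ζ| := by
      rw [integral_add (hhi.mono_set hsub) ((hui.mono_set hsub).const_mul L), integral_const_mul]
    _ ≤ _ := by
      refine add_le_add_left ?_ _
      exact setIntegral_Icc_zero_mono hw hhi fun _ => abs_nonneg _

/-- Along a path, the `i`-th particle stays close to the solution of the equation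
`X = y + ∫_{[0,·]} (ā besselF ((ā - 1) ζ₁ ζ₂) y - X) + bᵢ` in which the empirical mean is replaced by
its noiseless value, up to a multiple of the integral of the averaged noise. -/
lemma abs_particle_sub_le {N : ℕ} {a : Fin N → ℝ} {X b : Fin N → ℝ × ℝ → ℝ} {S : ℝ × ℝ}
    {y C : ℝ} (hC : |(1 / (N : ℝ)) * ∑ j, a j| ≤ C)
    (hX : ∀ j, ContinuousOn (X j) (Set.Icc 0 S)) (hb : ∀ j, ContinuousOn (b j) (Set.Icc 0 S))
    (heq : ∀ j, ∀ z ∈ Set.Icc 0 S, X j z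
      = y + (∫ ζ in Set.Icc 0 z, ((1 / (N : ℝ)) * ∑ k, a k * X k ζ - X j ζ)) + b j z)
    (i : Fin N) {z : ℝ × ℝ} (hz : z ∈ Set.Icc 0 S) :
    |X i z - besselF (((1 / (N : ℝ)) * ∑ j, a j - 1) * (z.1 * z.2)) * y
        - goursatResolvent (b i) z|
      ≤ 2 * Real.exp (3 * (S.1 + S.2)) * (1 + 2 * Real.exp ((2 * (C + 1) + 1) * (S.1 + S.2))
          * (C + 1) * volume.real (Set.Icc 0 S))
        * ∫ ζ in Set.Icc 0 S, |(1 / (N : ℝ)) * ∑ j, a j * b j ζ| := by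
  have hC0 : 0 ≤ C := (abs_nonneg _).trans hC
  set α := (1 / (N : ℝ)) * ∑ j, a j with hα
  set β : ℝ × ℝ → ℝ := fun ζ => (1 / (N : ℝ)) * ∑ j, a j * b j ζ with hβ
  set M : ℝ × ℝ → ℝ := fun ζ => (1 / (N : ℝ)) * ∑ j, a j * X j ζ with hM
  set f : ℝ × ℝ → ℝ := fun ζ => besselF ((α - 1) * (ζ.1 * ζ.2)) * y with hf
  have hβc : ContinuousOn β (Set.Icc 0 S) := by fun_prop
  have hMc : ContinuousOn M (Set.Icc 0 S) := by fun_prop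
  have hfc : ContinuousOn f (Set.Icc 0 S) := by fun_prop
  have hint : ∀ {g : ℝ × ℝ → ℝ} {w : ℝ × ℝ}, ContinuousOn g (Set.Icc 0 S) → w ∈ Set.Icc 0 S →
      IntegrableOn g (Set.Icc 0 w) := fun hg hw =>
    (hg.mono (Set.Icc_subset_Icc_right hw.2)).integrableOn_compact isCompact_Icc
  have hfeq : ∀ w ∈ Set.Icc 0 S, f w = y + (α - 1) * ∫ ζ in Set.Icc 0 w, f ζ := by
    intro w hw
    simp only [hf]
    rw [integral_mul_const, besselF_eq_one_add_integral (α - 1) hw.1]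
    ring
  have hMeq : ∀ w ∈ Set.Icc 0 S, M w = α * y + (α - 1) * (∫ ζ in Set.Icc 0 w, M ζ) + β w := by
    intro w hw
    have h1 : ∀ j, a j * X j w = a j * y + (a j * (∫ ζ in Set.Icc 0 w, M ζ)
        - ∫ ζ in Set.Icc 0 w, a j * X j ζ) + a j * b j w := by
      intro j
      rw [heq j w hw, integral_sub (hint hMc hw) (hint (hX j) hw), integral_const_mul (a j)]
      ring
    have h2 : ∫ ζ in Set.Icc 0 w, M ζ
        = (1 / (N : ℝ)) * ∑ j, ∫ ζ in Set.Icc 0 w, a j * X j ζ := by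
      simp only [hM]
      rw [integral_const_mul, integral_finsetSum _ fun j _ => (hint (hX j) hw).const_mul (a j)]
    have h3 : M w = (1 / (N : ℝ)) * ∑ j, a j * X j w := rfl
    rw [h3, Finset.sum_congr rfl fun j _ => h1 j, Finset.sum_add_distrib, Finset.sum_add_distrib,
      Finset.sum_sub_distrib, ← Finset.sum_mul, ← Finset.sum_mul]
    have h4 : (1 / (N : ℝ)) * ∑ j, ∫ ζ in Set.Icc 0 w, a j * X j ζ
        = ∫ ζ in Set.Icc 0 w, M ζ := h2.symm
    linear_combination -h4
  -- the fluctuation `m` of the empirical mean; `m - β` solves a linear equation with source `β`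
  set m : ℝ × ℝ → ℝ := fun ζ => M ζ - α * f ζ with hm
  have hmc : ContinuousOn m (Set.Icc 0 S) := by fun_prop
  have hm_le : ∀ w ∈ Set.Icc 0 S, |m w - β w|
      ≤ 2 * Real.exp ((2 * (C + 1) + 1) * (S.1 + S.2))
        * ((C + 1) * ∫ ζ in Set.Icc 0 S, |β ζ|) := by
    intro w hw
    have hα1 : |α - 1| ≤ C + 1 := (abs_sub _ _).trans (by simpa using hC)
    have h := abs_le_of_eq_setIntegral (u := fun ζ => m ζ - β ζ) (h := fun ζ => (α - 1) * β ζ)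
      hα1 (by fun_prop) (by fun_prop) (fun v hv => ?_) hw
    · refine h.trans ?_
      gcongr
      simp_rw [abs_mul]
      rw [integral_const_mul]
      gcongr
    · have h5 : ∀ ζ, (α - 1) * (m ζ - β ζ) + (α - 1) * β ζ = (α - 1) * (M ζ - α * f ζ) := by
        intro ζ; simp only [hm]; ring
      simp_rw [h5]
      rw [integral_const_mul (α - 1), integral_sub (hint hMc hv) ((hint hfc hv).const_mul α),
        integral_const_mul α]
      simp only [hm]
      linear_combination hMeq v hv - α * hfeq v hv
  have hRc := continuousOn_goursatResolvent (hb i)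
  have hD := abs_le_of_eq_setIntegral (u := fun w => X i w - f w - goursatResolvent (b i) w)
    (h := m) (c := -1) (L := 1) (S := S) (by simp) (((hX i).sub hfc).sub hRc) hmc
    (fun w hw => ?_) hz
  · refine hD.trans ?_
    have hβi : IntegrableOn (fun ζ => |β ζ|) (Set.Icc 0 S) :=
      hβc.abs.integrableOn_compact isCompact_Icc
    have hmI : ∫ ζ in Set.Icc 0 S, |m ζ| ≤ (∫ ζ in Set.Icc 0 S, |β ζ|)
        + volume.real (Set.Icc 0 S) * (2 * Real.exp ((2 * (C + 1) + 1) * (S.1 + S.2))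
        * ((C + 1) * ∫ ζ in Set.Icc 0 S, |β ζ|)) := by
      have hfin : volume (Set.Icc 0 S) ≠ ⊤ := isCompact_Icc.measure_lt_top.ne
      rw [← smul_eq_mul (volume.real _), ← setIntegral_const,
        ← integral_add hβi (integrableOn_const hfin)]
      refine setIntegral_mono_on (hmc.abs.integrableOn_compact isCompact_Icc)
        (hβi.add (integrableOn_const hfin)) measurableSet_Icc fun ζ hζ => ?_
      have h1 := hm_le ζ hζ
      have h2 : |m ζ| ≤ |β ζ| + |m ζ - β ζ| := by
        simpa using abs_add_le (β ζ) (m ζ - β ζ)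
      linarith
    calc _ ≤ 2 * Real.exp ((2 * 1 + 1) * (S.1 + S.2)) * _ :=
          mul_le_mul_of_nonneg_left hmI (by positivity)
      _ = _ := by
        norm_num only
        ring
  · have hXw := heq i w hw
    rw [integral_sub (hint hMc hw) (hint (hX i) hw)] at hXw
    have hRw := goursatResolvent_eq (hint (hb i) hw)
    have h6 : ∀ ζ, -1 * (X i ζ - f ζ - goursatResolvent (b i) ζ) + m ζ
        = M ζ - X i ζ - ((α - 1) * f ζ) + goursatResolvent (b i) ζ := by
      intro ζ; simp only [hm]; ring
    simp_rw [h6]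
    have h7 : ∫ ζ in Set.Icc 0 w, (M ζ - X i ζ - ((α - 1) * f ζ) + goursatResolvent (b i) ζ)
        = (∫ ζ in Set.Icc 0 w, (M ζ - X i ζ - (α - 1) * f ζ))
          + ∫ ζ in Set.Icc 0 w, goursatResolvent (b i) ζ :=
      integral_add (((hint hMc hw).sub (hint (hX i) hw)).sub ((hint hfc hw).const_mul (α - 1)))
        (hint hRc hw)
    have h8 : ∫ ζ in Set.Icc 0 w, (M ζ - X i ζ - (α - 1) * f ζ)
        = (∫ ζ in Set.Icc 0 w, (M ζ - X i ζ)) - ∫ ζ in Set.Icc 0 w, (α - 1) * f ζ :=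
      integral_sub ((hint hMc hw).sub (hint (hX i) hw)) ((hint hfc hw).const_mul (α - 1))
    rw [h7, h8, integral_sub (hint hMc hw) (hint (hX i) hw), integral_const_mul (α - 1)]
    linear_combination hXw - hfeq w hw - hRw

/-! ### Approximation by simple functions -/

lemma MeasureTheory.SimpleFunc.comp_eq_sum_indicator {α β : Type*} [MeasurableSpace α]
    (d : SimpleFunc α β) (g : β → ℝ) (x : α) :
    g (d x) = ∑ w ∈ d.range, (d ⁻¹' {w}).indicator (fun _ => g w) x := by
  rw [Finset.sum_eq_single (d x) _ fun h => absurd (d.mem_range_self x) h]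
  · simp
  · intro w _ hw
    exact Set.indicator_of_notMem (fun h => hw h.symm) _

/-- Simple functions with values in `[0, z]` that converge to the identity on `[0, z]`. -/
noncomputable def rectApprox {z : ℝ × ℝ} (hz : 0 ≤ z) (n : ℕ) : SimpleFunc (ℝ × ℝ) (ℝ × ℝ) :=
  SimpleFunc.approxOn id measurable_id (Set.Icc 0 z) 0 ⟨le_rfl, hz⟩ n

lemma rectApprox_mem {z : ℝ × ℝ} (hz : 0 ≤ z) (n : ℕ) (ζ : ℝ × ℝ) :
    rectApprox hz n ζ ∈ Set.Icc 0 z :=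
  SimpleFunc.approxOn_mem measurable_id _ n ζ

lemma tendsto_rectApprox {z : ℝ × ℝ} (hz : 0 ≤ z) {ζ : ℝ × ℝ} (hζ : ζ ∈ Set.Icc 0 z) :
    Tendsto (fun n => rectApprox hz n ζ) atTop (𝓝[Set.Icc 0 z] ζ) :=
  tendsto_nhdsWithin_iff.2 ⟨SimpleFunc.tendsto_approxOn measurable_id _ (subset_closure hζ),
    Eventually.of_forall fun n => rectApprox_mem hz n ζ⟩

/-- A process whose paths are almost surely continuous is jointly measurable. -/
lemma aestronglyMeasurable_of_continuousOn_paths {Ω : Type*} [MeasurableSpace Ω] {P : Measure Ω}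
    [SFinite P] {X : ℝ × ℝ → Ω → ℝ} {S : ℝ × ℝ} (hS : 0 ≤ S)
    (hmeas : ∀ z ∈ Set.Icc 0 S, AEStronglyMeasurable (X z) P)
    (hcont : ∀ᵐ ω ∂P, ContinuousOn (fun z => X z ω) (Set.Icc 0 S)) :
    AEStronglyMeasurable (fun p : (ℝ × ℝ) × Ω => X p.1 p.2)
      ((volume.restrict (Set.Icc 0 S)).prod P) := by
  refine aestronglyMeasurable_of_tendsto_ae atTop
    (f := fun n (p : (ℝ × ℝ) × Ω) => X (rectApprox hS n p.1) p.2) (fun n => ?_) ?_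
  · have h : (fun p : (ℝ × ℝ) × Ω => X (rectApprox hS n p.1) p.2)
        = fun p => ∑ w ∈ (rectApprox hS n).range,
          (Prod.fst ⁻¹' (rectApprox hS n ⁻¹' {w})).indicator (fun q => X w q.2) p := by
      ext p
      rw [(rectApprox hS n).comp_eq_sum_indicator (fun w => X w p.2)]
      rfl
    rw [h]
    refine Finset.aestronglyMeasurable_fun_sum _ fun w hw => ?_
    obtain ⟨ζ, rfl⟩ := SimpleFunc.mem_range.1 hw
    exact (hmeas _ (rectApprox_mem hS n ζ)).comp_snd.indicator
      (measurable_fst ((rectApprox hS n).measurableSet_fiber _))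
  · filter_upwards [Measure.quasiMeasurePreserving_fst.ae (ae_restrict_mem measurableSet_Icc),
      Measure.quasiMeasurePreserving_snd.ae hcont] with p hp1 hp2
    exact (hp2 p.1 hp1).tendsto.comp (tendsto_rectApprox hS hp1)

/-! ### Integrals of step functions -/

lemma stepFun_sub (c d : ℝ × ℝ →₀ ℝ) (ζ : ℝ × ℝ) :
    stepFun (c - d) ζ = stepFun c ζ - stepFun d ζ :=
  Finsupp.sum_sub_index fun w r s => by
    by_cases h : ζ ∈ Set.Icc 0 w <;> simp [h]

lemma stepIntegral_sub {Ω : Type*} {B : ℝ × ℝ → Ω → ℝ} (c d : ℝ × ℝ →₀ ℝ) (ω : Ω) :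
    stepIntegral B (c - d) ω = stepIntegral B c ω - stepIntegral B d ω :=
  Finsupp.sum_sub_index fun _ r s => sub_mul r s _

section StepIntegral

variable {Ω : Type*} [MeasurableSpace Ω] {P : Measure Ω} {B : ℝ × ℝ → Ω → ℝ}

lemma IsBrownianSheet.hasGaussianLaw (hB : IsBrownianSheet P B) {z : ℝ × ℝ} (hz : 0 ≤ z) :
    HasGaussianLaw (B z) P :=
  hB.gaussian.hasGaussianLaw_eval ⟨z, hz⟩

lemma IsBrownianSheet.memLp (hB : IsBrownianSheet P B) {z : ℝ × ℝ} (hz : 0 ≤ z) :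
    MemLp (B z) 2 P :=
  (hB.hasGaussianLaw hz).memLp_two

lemma volume_restrict_Ici_Icc {w : ℝ × ℝ} (hw : 0 ≤ w) :
    (volume.restrict (Set.Ici 0)).real (Set.Icc 0 w) = w.1 * w.2 := by
  rw [measureReal_restrict_apply measurableSet_Icc,
    Set.inter_eq_left.2 Set.Icc_subset_Ici_self, Icc_zero_prod, Measure.volume_eq_prod,
    measureReal_prod_prod, Real.volume_real_Icc_of_le (a := 0) hw.1,
    Real.volume_real_Icc_of_le (a := 0) hw.2, sub_zero, sub_zero]

lemma memLp_indicator_Icc (w : ℝ × ℝ) (r : ℝ) :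
    MemLp ((Set.Icc 0 w).indicator fun _ => r) 2 (volume.restrict (Set.Ici 0)) :=
  memLp_indicator_const 2 measurableSet_Icc r
    (Or.inr ((Measure.restrict_apply_le _ _).trans_lt isCompact_Icc.measure_lt_top).ne)

lemma memLp_stepFun (c : ℝ × ℝ →₀ ℝ) : MemLp (stepFun c) 2 (volume.restrict (Set.Ici 0)) :=
  memLp_finsetSum _ fun w _ => memLp_indicator_Icc w (c w)

lemma IsBrownianSheet.memLp_stepIntegral (hB : IsBrownianSheet P B) {c : ℝ × ℝ →₀ ℝ}
    (hc : ∀ w ∈ c.support, 0 ≤ w) : MemLp (stepIntegral B c) 2 P :=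
  memLp_finsetSum _ fun w hw => (hB.memLp (hc w hw)).const_mul (c w)

lemma IsBrownianSheet.integral_stepIntegral (hB : IsBrownianSheet P B) {c : ℝ × ℝ →₀ ℝ}
    (hc : ∀ w ∈ c.support, 0 ≤ w) : ∫ ω, stepIntegral B c ω ∂P = 0 := by
  simp only [stepIntegral, Finsupp.sum]
  rw [integral_finsetSum _ fun w hw =>
    ((hB.hasGaussianLaw (hc w hw)).integrable.const_mul (c w))]
  refine Finset.sum_eq_zero fun w hw => ?_
  rw [integral_const_mul, hB.mean w (hc w hw), mul_zero]

lemma integral_indicator_mul_indicator {v w : ℝ × ℝ} (hv : 0 ≤ v) (hw : 0 ≤ w) (r s : ℝ) :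
    ∫ ζ in Set.Ici (0 : ℝ × ℝ), (Set.Icc 0 v).indicator (fun _ => r) ζ
        * (Set.Icc 0 w).indicator (fun _ => s) ζ
      = r * s * (min v.1 w.1 * min v.2 w.2) := by
  have h : ∀ ζ : ℝ × ℝ, (Set.Icc 0 v).indicator (fun _ => r) ζ
      * (Set.Icc 0 w).indicator (fun _ => s) ζ
      = (Set.Icc 0 (v ⊓ w)).indicator (fun _ => r * s) ζ := by
    intro ζ
    rw [← Set.inter_indicator_mul, Set.Icc_inter_Icc, sup_idem]
  simp_rw [h]
  rw [integral_indicator_const _ measurableSet_Icc, volume_restrict_Ici_Icc (le_inf hv hw),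
    smul_eq_mul, mul_comm]
  rfl

/-- The Itô isometry for step functions. -/
lemma IsBrownianSheet.integral_stepIntegral_sq (hB : IsBrownianSheet P B) {c : ℝ × ℝ →₀ ℝ}
    (hc : ∀ w ∈ c.support, 0 ≤ w) :
    ∫ ω, stepIntegral B c ω ^ 2 ∂P = ∫ ζ in Set.Ici 0, stepFun c ζ ^ 2 := by
  simp only [stepIntegral, stepFun, Finsupp.sum, sq, Finset.sum_mul_sum]
  rw [integral_finsetSum, integral_finsetSum]
  · refine Finset.sum_congr rfl fun v hv => ?_
    rw [integral_finsetSum, integral_finsetSum]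
    · refine Finset.sum_congr rfl fun w hw => ?_
      rw [integral_indicator_mul_indicator (hc v hv) (hc w hw)]
      simp_rw [fun ω => mul_mul_mul_comm (c v) (B v ω) (c w) (B w ω)]
      rw [integral_const_mul, hB.covariance v w (hc v hv) (hc w hw)]
    · exact fun w _ => (memLp_indicator_Icc v (c v)).integrable_mul (memLp_indicator_Icc w (c w))
    · exact fun w hw => ((hB.memLp (hc v hv)).const_mul (c v)).integrable_mul
        ((hB.memLp (hc w hw)).const_mul (c w))
  · exact fun v _ => integrable_finsetSum _ fun w _ =>
      (memLp_indicator_Icc v (c v)).integrable_mul (memLp_indicator_Icc w (c w))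
  · exact fun v hv => integrable_finsetSum _ fun w hw =>
      ((hB.memLp (hc v hv)).const_mul (c v)).integrable_mul
        ((hB.memLp (hc w hw)).const_mul (c w))

lemma eLpNorm_two_eq_ofReal_sqrt {α : Type*} [MeasurableSpace α] {μ : Measure α} {f : α → ℝ}
    (hf : MemLp f 2 μ) : eLpNorm f 2 μ = ENNReal.ofReal √(∫ x, f x ^ 2 ∂μ) := by
  rw [hf.eLpNorm_eq_integral_rpow_norm two_ne_zero ENNReal.ofNat_ne_top, Real.sqrt_eq_rpow]
  simp

lemma IsBrownianSheet.eLpNorm_stepIntegral (hB : IsBrownianSheet P B) {c : ℝ × ℝ →₀ ℝ}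
    (hc : ∀ w ∈ c.support, 0 ≤ w) :
    eLpNorm (stepIntegral B c) 2 P = eLpNorm (stepFun c) 2 (volume.restrict (Set.Ici 0)) := by
  rw [eLpNorm_two_eq_ofReal_sqrt (hB.memLp_stepIntegral hc),
    eLpNorm_two_eq_ofReal_sqrt (memLp_stepFun c), hB.integral_stepIntegral_sq hc]

/-- The integral of a step function is Gaussian, with a law that does not depend on the sheet. -/
lemma IsBrownianSheet.map_stepIntegral (hB : IsBrownianSheet P B) {c : ℝ × ℝ →₀ ℝ}
    (hc : ∀ w ∈ c.support, 0 ≤ w) :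
    P.map (stepIntegral B c)
      = gaussianReal 0 (∫ ζ in Set.Ici 0, stepFun c ζ ^ 2).toNNReal := by
  classical
  have h1 : HasGaussianLaw (stepIntegral B c) P := by
    have h2 := (hB.gaussian.smul fun z : Set.Ici (0 : ℝ × ℝ) => c z).hasGaussianLaw_fun_sum
      (I := c.support.subtype (· ∈ Set.Ici 0))
    refine h2.congr (ae_of_all _ fun ω => ?_)
    exact Finset.sum_subtype_of_mem (fun w => c w * B w ω) hc
  have := hB.gaussian.isProbabilityMeasure
  rw [h1.map_eq_gaussianReal, hB.integral_stepIntegral hc,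
    variance_of_integral_eq_zero h1.aemeasurable (hB.integral_stepIntegral hc),
    hB.integral_stepIntegral_sq hc]

end StepIntegral

/-! ### The resolvent of a Brownian sheet as a Wiener integral -/

/-- The step function `1_{[0,z]} - ∑_w k(z - w) |{d = w} ∩ [0,z]| 1_{[0,w]}`, where `d` runs through the
simple functions `rectApprox` and `k(s) = besselF (-(s₁ s₂))`. -/
noncomputable def resolventStep {z : ℝ × ℝ} (hz : 0 ≤ z) (n : ℕ) : ℝ × ℝ →₀ ℝ :=
  Finsupp.single z 1 - ∑ w ∈ (rectApprox hz n).range,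
    Finsupp.single w (besselF (-((z.1 - w.1) * (z.2 - w.2)))
      * (volume.restrict (Set.Icc 0 z)).real (rectApprox hz n ⁻¹' {w}))

lemma resolventStep_support {z : ℝ × ℝ} (hz : 0 ≤ z) (n : ℕ) :
    ∀ w ∈ (resolventStep hz n).support, 0 ≤ w := by
  classical
  intro w hw
  rcases Finset.mem_union.1 (Finsupp.support_sub hw) with h | h
  · rw [Finset.mem_singleton.1 (Finsupp.support_single_subset h)]
    exact hz
  · obtain ⟨v, hv, hwv⟩ := Finset.mem_biUnion.1 (Finsupp.support_finsetSum h)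
    rw [Finset.mem_singleton.1 (Finsupp.support_single_subset hwv)]
    obtain ⟨ζ, rfl⟩ := SimpleFunc.mem_range.1 hv
    exact (rectApprox_mem hz n ζ).1

lemma resolventStep_sum {z : ℝ × ℝ} (hz : 0 ≤ z) (n : ℕ) (g : ℝ × ℝ → ℝ) :
    (resolventStep hz n).sum (fun w r => r * g w) = g z - ∫ ζ in Set.Icc 0 z,
      besselF (-((z.1 - (rectApprox hz n ζ).1) * (z.2 - (rectApprox hz n ζ).2)))
        * g (rectApprox hz n ζ) := by
  have := isFiniteMeasure_restrict_rect z
  simp_rw [(rectApprox hz n).comp_eq_sum_indicator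
    (fun w => besselF (-((z.1 - w.1) * (z.2 - w.2))) * g w)]
  rw [integral_finsetSum _ fun w _ => (integrable_const _).indicator
      ((rectApprox hz n).measurableSet_fiber w), resolventStep,
    Finsupp.sum_sub_index fun _ r s => sub_mul r s _, Finsupp.sum_single_index (zero_mul _),
    one_mul, ← Finsupp.sum_finsetSum_index (fun _ => zero_mul _) fun _ r s => add_mul r s _]
  congr 1
  refine Finset.sum_congr rfl fun w _ => ?_
  rw [Finsupp.sum_single_index (zero_mul _),
    integral_indicator_const _ ((rectApprox hz n).measurableSet_fiber w), smul_eq_mul]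
  ring

lemma tendsto_resolventStep_sum {z : ℝ × ℝ} (hz : 0 ≤ z) {g : ℝ × ℝ → ℝ} {C : ℝ}
    (hbd : ∀ w ∈ Set.Icc 0 z, |g w| ≤ C)
    (hcont : ∀ᵐ w ∂volume.restrict (Set.Icc 0 z), ContinuousWithinAt g (Set.Icc 0 z) w) :
    Tendsto (fun n => (resolventStep hz n).sum (fun w r => r * g w)) atTop
      (𝓝 (goursatResolvent g z)) := by
  have := isFiniteMeasure_restrict_rect z
  simp_rw [resolventStep_sum]
  refine tendsto_const_nhds.sub (tendsto_integral_of_dominated_convergence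
    (fun _ => Real.exp (z.1 * z.2) * C) (fun n => ?_) (integrable_const _) (fun n => ?_) ?_)
  · exact ((rectApprox hz n).map
      fun w => besselF (-((z.1 - w.1) * (z.2 - w.2))) * g w).aestronglyMeasurable
  · refine ae_of_all _ fun ζ => ?_
    rw [norm_mul]
    exact mul_le_mul (abs_kernel_le ⟨hz, le_rfl⟩ (rectApprox_mem hz n ζ))
      (hbd _ (rectApprox_mem hz n ζ)) (norm_nonneg _) (Real.exp_pos _).le
  · filter_upwards [hcont, ae_restrict_mem measurableSet_Icc] with ζ h1 h2
    have h3 := tendsto_rectApprox hz h2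
    have h4 : Continuous fun w : ℝ × ℝ => besselF (-((z.1 - w.1) * (z.2 - w.2))) := by fun_prop
    exact ((h4.tendsto ζ).comp (tendsto_nhds_of_tendsto_nhdsWithin h3)).mul (h1.tendsto.comp h3)

lemma abs_resolventStep_sum_le {z : ℝ × ℝ} (hz : 0 ≤ z) {g : ℝ × ℝ → ℝ} {C : ℝ}
    (hbd : ∀ w ∈ Set.Icc 0 z, |g w| ≤ C) (n : ℕ) :
    |(resolventStep hz n).sum (fun w r => r * g w)|
      ≤ C * (1 + Real.exp (z.1 * z.2) * volume.real (Set.Icc 0 z)) := by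
  rw [resolventStep_sum]
  have h : ‖∫ ζ in Set.Icc 0 z,
      besselF (-((z.1 - (rectApprox hz n ζ).1) * (z.2 - (rectApprox hz n ζ).2)))
        * g (rectApprox hz n ζ)‖ ≤ (Real.exp (z.1 * z.2) * C) * volume.real (Set.Icc 0 z) := by
    refine norm_setIntegral_le_of_norm_le_const isCompact_Icc.measure_lt_top fun ζ _ => ?_
    rw [norm_mul]
    exact mul_le_mul (abs_kernel_le ⟨hz, le_rfl⟩ (rectApprox_mem hz n ζ))
      (hbd _ (rectApprox_mem hz n ζ)) (norm_nonneg _) (Real.exp_pos _).le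
  have h2 := hbd z ⟨hz, le_rfl⟩
  refine (abs_sub _ _).trans ?_
  rw [Real.norm_eq_abs] at h
  linarith

/-- The integrand `ζ ↦ 1_{[0,z]}(ζ) besselF (-((z₁ - ζ₁) (z₂ - ζ₂)))`. -/
noncomputable def besselIntegrand (z : ℝ × ℝ) : ℝ × ℝ → ℝ :=
  (Set.Icc 0 z).indicator fun ζ => besselF (-((z.1 - ζ.1) * (z.2 - ζ.2)))

/-- The integrand is the superposition of indicators `1_{[0,w]}` that corresponds to
`goursatResolvent`. -/
lemma goursatResolvent_indicator {z ζ : ℝ × ℝ} (hζ : 0 ≤ ζ) :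
    goursatResolvent (fun w => (Set.Icc 0 w).indicator (fun _ => 1) ζ) z = besselIntegrand z ζ := by
  have h0 : ∀ w, (Set.Icc 0 z).indicator (fun w => besselF (-((z.1 - w.1) * (z.2 - w.2)))
        * (Set.Icc 0 w).indicator (fun _ => 1) ζ) w
      = (Set.Icc ζ z).indicator (fun w => besselF (-((z.1 - w.1) * (z.2 - w.2)))) w := by
    intro w
    by_cases h1 : w ∈ Set.Icc ζ z
    · rw [Set.indicator_of_mem h1, Set.indicator_of_mem (show w ∈ Set.Icc 0 z from ⟨hζ.trans h1.1, h1.2⟩),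
        Set.indicator_of_mem (show ζ ∈ Set.Icc 0 w from ⟨hζ, h1.1⟩), mul_one]
    · rw [Set.indicator_of_notMem h1]
      by_cases h2 : w ∈ Set.Icc 0 z
      · rw [Set.indicator_of_mem h2, Set.indicator_of_notMem fun h3 => h1 ⟨h3.2, h2.2⟩, mul_zero]
      · rw [Set.indicator_of_notMem h2]
  rw [goursatResolvent, ← integral_indicator measurableSet_Icc, funext h0,
    integral_indicator measurableSet_Icc, besselIntegrand]
  by_cases h : ζ ≤ z
  · have hm : ζ ∈ Set.Icc 0 z := ⟨hζ, h⟩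
    rw [setIntegral_kernel_right h, Set.indicator_of_mem hm, Set.indicator_of_mem hm]
    ring
  · have hm : ζ ∉ Set.Icc 0 z := fun h' => h h'.2
    rw [Set.Icc_eq_empty h, setIntegral_empty, Set.indicator_of_notMem hm,
      Set.indicator_of_notMem hm, sub_zero]

lemma stepFun_eq_sum (c : ℝ × ℝ →₀ ℝ) (ζ : ℝ × ℝ) :
    stepFun c ζ = c.sum fun w r => r * (Set.Icc 0 w).indicator (fun _ => 1) ζ :=
  Finset.sum_congr rfl fun w _ => by
    by_cases h : ζ ∈ Set.Icc 0 w <;> simp [h]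

lemma abs_indicator_one_le (ζ w : ℝ × ℝ) :
    |(Set.Icc 0 w).indicator (fun _ => (1 : ℝ)) ζ| ≤ 1 := by
  by_cases h : ζ ∈ Set.Icc 0 w <;> simp [h]

lemma tendsto_stepFun_resolventStep {z : ℝ × ℝ} (hz : 0 ≤ z) {ζ : ℝ × ℝ} (hζ : 0 ≤ ζ) :
    Tendsto (fun n => stepFun (resolventStep hz n) ζ) atTop (𝓝 (besselIntegrand z ζ)) := by
  simp_rw [stepFun_eq_sum, ← goursatResolvent_indicator hζ]
  refine tendsto_resolventStep_sum hz (C := 1) (fun w _ => abs_indicator_one_le ζ w)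
    (ae_restrict_of_ae ?_)
  filter_upwards [ae_fst_ne_and_snd_ne ζ] with w hw
  refine (ContinuousAt.continuousWithinAt ?_)
  refine (tendsto_const_nhds (x := (Set.Icc 0 w).indicator (fun _ => (1 : ℝ)) ζ)).congr' ?_
  filter_upwards [eventually_mem_Icc_zero_iff hw.1.symm hw.2.symm] with v hv
  by_cases h : ζ ∈ Set.Icc 0 w
  · rw [Set.indicator_of_mem h, Set.indicator_of_mem (hv.2 h)]
  · rw [Set.indicator_of_notMem h, Set.indicator_of_notMem fun h' => h (hv.1 h')]

lemma memLp_besselIntegrand (z : ℝ × ℝ) :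
    MemLp (besselIntegrand z) 2 (volume.restrict (Set.Ici 0)) := by
  rw [besselIntegrand, memLp_indicator_iff_restrict measurableSet_Icc]
  have hc : Continuous fun ζ : ℝ × ℝ => besselF (-((z.1 - ζ.1) * (z.2 - ζ.2))) := by fun_prop
  have := isFiniteMeasure_restrict_rect z
  rw [Measure.restrict_restrict measurableSet_Icc, Set.inter_eq_left.2 Set.Icc_subset_Ici_self]
  refine MemLp.of_bound hc.aestronglyMeasurable (Real.exp (z.1 * z.2)) ?_
  filter_upwards [ae_restrict_mem measurableSet_Icc] with ζ hζ
  exact abs_kernel_le ⟨hζ.1.trans hζ.2, le_rfl⟩ hζ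

lemma stepFun_resolventStep_of_not_le {z : ℝ × ℝ} (hz : 0 ≤ z) (n : ℕ) {ζ : ℝ × ℝ} (h : ¬ ζ ≤ z) :
    stepFun (resolventStep hz n) ζ = 0 := by
  rw [stepFun_eq_sum, resolventStep_sum, Set.indicator_of_notMem fun h' => h h'.2]
  have : ∀ w, (Set.Icc 0 (rectApprox hz n w)).indicator (fun _ => (1 : ℝ)) ζ = 0 := fun w =>
    Set.indicator_of_notMem (fun h' => h (h'.2.trans (rectApprox_mem hz n w).2)) _
  simp [this]

lemma tendsto_eLpNorm_stepFun_resolventStep {z : ℝ × ℝ} (hz : 0 ≤ z) :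
    Tendsto (fun n => eLpNorm (fun ζ => stepFun (resolventStep hz n) ζ - besselIntegrand z ζ) 2
      (volume.restrict (Set.Ici 0))) atTop (𝓝 0) := by
  set K : ℝ := 1 * (1 + Real.exp (z.1 * z.2) * volume.real (Set.Icc 0 z)) with hK
  have hle : ∀ n ζ, |stepFun (resolventStep hz n) ζ| ≤ K := fun n ζ => by
    rw [stepFun_eq_sum]
    exact abs_resolventStep_sum_le hz (fun w _ => abs_indicator_one_le ζ w) n
  have hlim : ∀ ζ : ℝ × ℝ, 0 ≤ ζ → |besselIntegrand z ζ| ≤ K := fun ζ hζ =>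
    le_of_tendsto (tendsto_stepFun_resolventStep hz hζ).abs (Eventually.of_forall fun n => hle n ζ)
  simp_rw [eLpNorm_eq_lintegral_rpow_enorm_toReal two_ne_zero ENNReal.ofNat_ne_top]
  have h0 : Tendsto (fun n => ∫⁻ ζ in Set.Ici 0,
      ‖stepFun (resolventStep hz n) ζ - besselIntegrand z ζ‖ₑ ^ (2 : ENNReal).toReal) atTop
      (𝓝 (∫⁻ _ in Set.Ici (0 : ℝ × ℝ), 0)) := by
    refine tendsto_lintegral_of_dominated_convergence'
      ((Set.Icc 0 z).indicator fun _ => (ENNReal.ofReal (2 * K)) ^ (2 : ENNReal).toReal)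
      (fun n => ?_) (fun n => ?_) ?_ ?_
    · exact ((memLp_stepFun _).sub (memLp_besselIntegrand z)).aestronglyMeasurable.enorm.pow_const _
    · filter_upwards [ae_restrict_mem measurableSet_Ici] with ζ hζ
      by_cases h : ζ ∈ Set.Icc 0 z
      · rw [Set.indicator_of_mem h, Real.enorm_eq_ofReal_abs]
        gcongr
        have h1 := hle n ζ
        have h2 := hlim ζ hζ
        have h3 := abs_sub (stepFun (resolventStep hz n) ζ) (besselIntegrand z ζ)
        linarith
      · have h' : ¬ ζ ≤ z := fun h'' => h ⟨hζ, h''⟩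
        rw [Set.indicator_of_notMem h, stepFun_resolventStep_of_not_le hz n h', besselIntegrand,
          Set.indicator_of_notMem h]
        simp
    · rw [lintegral_indicator_const measurableSet_Icc]
      refine ENNReal.mul_ne_top (ENNReal.rpow_ne_top_of_nonneg (by simp) ENNReal.ofReal_ne_top) ?_
      exact ((Measure.restrict_apply_le _ _).trans_lt isCompact_Icc.measure_lt_top).ne
    · filter_upwards [ae_restrict_mem measurableSet_Ici] with ζ hζ
      have h1 := ((tendsto_stepFun_resolventStep hz hζ).sub_const (besselIntegrand z ζ)).enorm
      have h2 := h1.ennrpow_const (2 : ENNReal).toReal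
      simpa using h2
  rw [lintegral_zero] at h0
  simpa using h0.ennrpow_const (1 / (2 : ENNReal).toReal)

section Sheet

variable {Ω : Type*} [MeasurableSpace Ω] {P : Measure Ω} {B : ℝ × ℝ → Ω → ℝ}

lemma IsBrownianSheet.ae_tendsto_stepIntegral (hB : IsBrownianSheet P B) {z : ℝ × ℝ} (hz : 0 ≤ z) :
    ∀ᵐ ω ∂P, Tendsto (fun n => stepIntegral B (resolventStep hz n) ω) atTop
      (𝓝 (goursatResolvent (fun w => B w ω) z)) := by
  filter_upwards [hB.continuous_paths] with ω hω
  have hc : ContinuousOn (fun w => B w ω) (Set.Icc 0 z) := hω.mono Set.Icc_subset_Ici_self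
  obtain ⟨C, hC⟩ := isCompact_Icc.exists_bound_of_continuousOn hc
  refine tendsto_resolventStep_sum hz hC ?_
  filter_upwards [ae_restrict_mem measurableSet_Icc] with w hw using hc w hw

lemma IsBrownianSheet.aestronglyMeasurable_goursatResolvent (hB : IsBrownianSheet P B)
    {z : ℝ × ℝ} (hz : 0 ≤ z) :
    AEStronglyMeasurable (fun ω => goursatResolvent (fun w => B w ω) z) P :=
  aestronglyMeasurable_of_tendsto_ae atTop
    (fun n => (hB.memLp_stepIntegral (resolventStep_support hz n)).aestronglyMeasurable)
    (hB.ae_tendsto_stepIntegral hz)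

/-- By the isometry the step integrals are Cauchy in `L²`, so that their almost sure limit is also
their limit in `L²`. -/
lemma IsBrownianSheet.tendsto_eLpNorm_stepIntegral (hB : IsBrownianSheet P B) {z : ℝ × ℝ}
    (hz : 0 ≤ z) :
    Tendsto (fun n => eLpNorm (fun ω => stepIntegral B (resolventStep hz n) ω
      - goursatResolvent (fun w => B w ω) z) 2 P) atTop (𝓝 0) := by
  set e : ℕ → ENNReal := fun n =>
    eLpNorm (fun ζ => stepFun (resolventStep hz n) ζ - besselIntegrand z ζ) 2
      (volume.restrict (Set.Ici 0)) with he
  have he0 : Tendsto e atTop (𝓝 0) := tendsto_eLpNorm_stepFun_resolventStep hz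
  have hsupp : ∀ n m, ∀ w ∈ (resolventStep hz n - resolventStep hz m).support, 0 ≤ w := by
    classical
    intro n m w hw
    rcases Finset.mem_union.1 (Finsupp.support_sub hw) with h | h
    exacts [resolventStep_support hz n w h, resolventStep_support hz m w h]
  have hcauchy : ∀ n m, eLpNorm (stepIntegral B (resolventStep hz n - resolventStep hz m)) 2 P
      ≤ e n + e m := by
    intro n m
    rw [hB.eLpNorm_stepIntegral (hsupp n m)]
    have h1 : stepFun (resolventStep hz n - resolventStep hz m)
        = (fun ζ => stepFun (resolventStep hz n) ζ - besselIntegrand z ζ)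
          - fun ζ => stepFun (resolventStep hz m) ζ - besselIntegrand z ζ := by
      ext ζ
      simp [stepFun_sub]
    rw [h1]
    exact eLpNorm_sub_le ((memLp_stepFun _).sub (memLp_besselIntegrand z)).aestronglyMeasurable
      ((memLp_stepFun _).sub (memLp_besselIntegrand z)).aestronglyMeasurable (by norm_num)
  refine tendsto_of_tendsto_of_tendsto_of_le_of_le tendsto_const_nhds he0 (fun _ => zero_le)
    fun n => ?_
  have hlim : ∀ᵐ ω ∂P, Tendsto
      (fun m => stepIntegral B (resolventStep hz n - resolventStep hz m) ω) atTop
      (𝓝 (stepIntegral B (resolventStep hz n) ω - goursatResolvent (fun w => B w ω) z)) := by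
    filter_upwards [hB.ae_tendsto_stepIntegral hz] with ω hω
    simp_rw [stepIntegral_sub]
    exact hω.const_sub _
  refine (Lp.eLpNorm_lim_le_liminf_eLpNorm
    (fun m => (hB.memLp_stepIntegral (hsupp n m)).aestronglyMeasurable) _ hlim).trans ?_
  refine (liminf_le_liminf (Eventually.of_forall fun m => hcauchy n m)).trans_eq ?_
  simpa using (he0.const_add (e n)).liminf_eq

lemma IsBrownianSheet.memLp_goursatResolvent (hB : IsBrownianSheet P B) {z : ℝ × ℝ} (hz : 0 ≤ z) :
    MemLp (fun ω => goursatResolvent (fun w => B w ω) z) 2 P := by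
  obtain ⟨n, hn⟩ := ((hB.tendsto_eLpNorm_stepIntegral hz).eventually_lt_const
    ENNReal.zero_lt_top).exists
  have h1 := hB.memLp_stepIntegral (resolventStep_support hz n)
  have h2 : MemLp (fun ω => stepIntegral B (resolventStep hz n) ω
      - goursatResolvent (fun w => B w ω) z) 2 P :=
    ⟨h1.aestronglyMeasurable.sub (hB.aestronglyMeasurable_goursatResolvent hz), hn⟩
  exact (h1.sub h2).ae_eq (ae_of_all _ fun ω => by simp)

lemma IsBrownianSheet.isWienerIntegral_goursatResolvent (hB : IsBrownianSheet P B) {z : ℝ × ℝ}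
    (hz : 0 ≤ z) :
    IsWienerIntegral P B (besselIntegrand z) fun ω => goursatResolvent (fun w => B w ω) z :=
  ⟨memLp_besselIntegrand z, hB.memLp_goursatResolvent hz, resolventStep hz,
    resolventStep_support hz, tendsto_eLpNorm_stepFun_resolventStep hz,
    hB.tendsto_eLpNorm_stepIntegral hz⟩

lemma IsBrownianSheet.integral_goursatResolvent (hB : IsBrownianSheet P B) {z : ℝ × ℝ}
    (hz : 0 ≤ z) : ∫ ω, goursatResolvent (fun w => B w ω) z ∂P = 0 := by
  have := hB.gaussian.isProbabilityMeasure
  have hS := fun n => hB.memLp_stepIntegral (resolventStep_support hz n)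
  have h1 : Tendsto (fun n => ∫ ω, stepIntegral B (resolventStep hz n) ω ∂P) atTop
      (𝓝 (∫ ω, goursatResolvent (fun w => B w ω) z ∂P)) := by
    refine tendsto_integral_of_L1' _ (hB.aestronglyMeasurable_goursatResolvent hz)
      (Eventually.of_forall fun n => (hS n).integrable one_le_two) ?_
    refine tendsto_of_tendsto_of_tendsto_of_le_of_le tendsto_const_nhds
      (hB.tendsto_eLpNorm_stepIntegral hz) (fun _ => zero_le) fun n => ?_
    exact eLpNorm_le_eLpNorm_of_exponent_le one_le_two
      ((hS n).sub (hB.memLp_goursatResolvent hz)).aestronglyMeasurable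
  refine tendsto_nhds_unique h1 ?_
  simp_rw [fun n => hB.integral_stepIntegral (resolventStep_support hz n)]
  exact tendsto_const_nhds

/-- The law of the resolvent does not depend on the sheet or on the probability space. -/
lemma IsBrownianSheet.map_goursatResolvent_eq (hB : IsBrownianSheet P B) {Ω' : Type*}
    [MeasurableSpace Ω'] {P' : Measure Ω'} {B' : ℝ × ℝ → Ω' → ℝ} (hB' : IsBrownianSheet P' B')
    {z : ℝ × ℝ} (hz : 0 ≤ z) :
    P.map (fun ω => goursatResolvent (fun w => B w ω) z)
      = P'.map (fun ω => goursatResolvent (fun w => B' w ω) z) := by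
  have := hB.gaussian.isProbabilityMeasure
  have := hB'.gaussian.isProbabilityMeasure
  have h := tendstoInDistribution_of_ae_tendsto
    (fun n => (hB.memLp_stepIntegral (resolventStep_support hz n)).aestronglyMeasurable.aemeasurable)
    (hB.aestronglyMeasurable_goursatResolvent hz).aemeasurable (hB.ae_tendsto_stepIntegral hz)
  have h' := tendstoInDistribution_of_ae_tendsto
    (fun n => (hB'.memLp_stepIntegral
      (resolventStep_support hz n)).aestronglyMeasurable.aemeasurable)
    (hB'.aestronglyMeasurable_goursatResolvent hz).aemeasurable (hB'.ae_tendsto_stepIntegral hz)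
  have heq := tendsto_nhds_unique h.tendsto (h'.tendsto.congr fun n => ?_)
  · exact congrArg Subtype.val heq
  · refine Subtype.ext ?_
    exact (hB'.map_stepIntegral (resolventStep_support hz n)).trans
      (hB.map_stepIntegral (resolventStep_support hz n)).symm

end Sheet

/-! ### The averaged noise -/

section ParticleSystem

variable {Ω : Type*} [MeasurableSpace Ω] {P : Measure Ω} {N : ℕ} {B : Fin N → ℝ × ℝ → Ω → ℝ}

lemma IsMultiBrownianSheet.integral_mul_eq_zero (hB : IsMultiBrownianSheet P B) {i j : Fin N}
    (hij : i ≠ j) {z : ℝ × ℝ} (hz : 0 ≤ z) : ∫ ω, B i z ω * B j z ω ∂P = 0 := by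
  have h : IndepFun (B i z) (B j z) P :=
    (hB.indep.indepFun hij).comp (measurable_pi_apply (⟨z, hz⟩ : Set.Ici (0 : ℝ × ℝ)))
      (measurable_pi_apply (⟨z, hz⟩ : Set.Ici (0 : ℝ × ℝ)))
  rw [h.integral_fun_mul_eq_mul_integral ((hB.sheet i).memLp hz).aestronglyMeasurable
    ((hB.sheet j).memLp hz).aestronglyMeasurable, (hB.sheet i).mean z hz, zero_mul]

/-- By independence, the averaged noise has variance of order `1 / N`. -/
lemma IsMultiBrownianSheet.lintegral_average_le (hB : IsMultiBrownianSheet P B) (hN : 0 < N)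
    {a : Fin N → ℝ} {C : ℝ} (ha : ∀ j, |a j| ≤ C) {S z : ℝ × ℝ} (hz : z ∈ Set.Icc 0 S) :
    ∫⁻ ω, ‖(1 / (N : ℝ)) * ∑ j, a j * B j z ω‖ₑ ∂P
      ≤ ENNReal.ofReal √(C ^ 2 * (S.1 * S.2) / N) := by
  have := (hB.sheet ⟨0, hN⟩).gaussian.isProbabilityMeasure
  have hL : ∀ j, MemLp (fun ω => a j * B j z ω) 2 P := fun j =>
    ((hB.sheet j).memLp hz.1).const_mul (a j)
  have hβ : MemLp (fun ω => (1 / (N : ℝ)) * ∑ j, a j * B j z ω) 2 P :=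
    (memLp_finsetSum _ fun j _ => hL j).const_mul _
  rw [← eLpNorm_one_eq_lintegral_enorm]
  refine (eLpNorm_le_eLpNorm_of_exponent_le one_le_two hβ.aestronglyMeasurable).trans ?_
  rw [eLpNorm_two_eq_ofReal_sqrt hβ]
  refine ENNReal.ofReal_le_ofReal (Real.sqrt_le_sqrt ?_)
  have hN' : (0 : ℝ) < N := by exact_mod_cast hN
  have hjk : ∀ j k, ∫ ω, a j * B j z ω * (a k * B k z ω) ∂P
      = if j = k then a j ^ 2 * (z.1 * z.2) else 0 := by
    intro j k
    simp_rw [fun ω => mul_mul_mul_comm (a j) (B j z ω) (a k) (B k z ω)]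
    rw [integral_const_mul]
    split_ifs with h
    · subst h
      rw [(hB.sheet j).covariance z z hz.1 hz.1, min_self, min_self, sq]
    · rw [hB.integral_mul_eq_zero h hz.1, mul_zero]
  have hLL : ∀ j k, Integrable (fun ω => a j * B j z ω * (a k * B k z ω)) P := fun j k =>
    (hL j).integrable_mul (hL k)
  have hsum : ∫ ω, (∑ j, a j * B j z ω) ^ 2 ∂P = ∑ j, a j ^ 2 * (z.1 * z.2) := by
    simp_rw [sq, Finset.sum_mul_sum]
    rw [integral_finsetSum _ fun j _ => integrable_finsetSum _ fun k _ => hLL j k]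
    refine Finset.sum_congr rfl fun j _ => ?_
    rw [integral_finsetSum _ fun k _ => hLL j k,
      Finset.sum_congr rfl fun k _ => hjk j k]
    simp [sq]
  simp_rw [mul_pow]
  rw [integral_const_mul, hsum]
  have hterm : ∀ j, a j ^ 2 * (z.1 * z.2) ≤ C ^ 2 * (S.1 * S.2) := by
    intro j
    have h1 : a j ^ 2 ≤ C ^ 2 := sq_le_sq' (abs_le.1 (ha j)).1 (abs_le.1 (ha j)).2
    have h2 : z.1 * z.2 ≤ S.1 * S.2 :=
      mul_le_mul hz.2.1 hz.2.2 hz.1.2 (hz.1.1.trans hz.2.1)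
    exact mul_le_mul h1 h2 (mul_nonneg hz.1.1 hz.1.2) (sq_nonneg _)
  calc (1 / (N : ℝ)) ^ 2 * ∑ j, a j ^ 2 * (z.1 * z.2)
      ≤ (1 / (N : ℝ)) ^ 2 * ∑ _j : Fin N, C ^ 2 * (S.1 * S.2) :=
        mul_le_mul_of_nonneg_left (Finset.sum_le_sum fun j _ => hterm j) (by positivity)
    _ = C ^ 2 * (S.1 * S.2) / N := by
      rw [Finset.sum_const, Finset.card_univ, Fintype.card_fin, nsmul_eq_mul]
      field_simp

lemma IsMultiBrownianSheet.aestronglyMeasurable_average [SFinite P]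
    (hB : IsMultiBrownianSheet P B) (a : Fin N → ℝ) {S : ℝ × ℝ} (hS : 0 ≤ S) :
    AEStronglyMeasurable (fun p : (ℝ × ℝ) × Ω => (1 / (N : ℝ)) * ∑ j, a j * B j p.1 p.2)
      ((volume.restrict (Set.Icc 0 S)).prod P) := by
  refine (Finset.aestronglyMeasurable_fun_sum _ fun j _ => ?_).const_mul _
  refine (aestronglyMeasurable_of_continuousOn_paths hS (fun z hz => ?_) ?_).const_mul (a j)
  · exact ((hB.sheet j).memLp hz.1).aestronglyMeasurable
  · exact (hB.sheet j).continuous_paths.mono fun ω hω => hω.mono Set.Icc_subset_Ici_self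

lemma IsMultiBrownianSheet.lintegral_integral_average_le (hB : IsMultiBrownianSheet P B)
    (hN : 0 < N) {a : Fin N → ℝ} {C : ℝ} (ha : ∀ j, |a j| ≤ C) {S : ℝ × ℝ} (hS : 0 ≤ S) :
    ∫⁻ ω, ‖∫ ζ in Set.Icc 0 S, |(1 / (N : ℝ)) * ∑ j, a j * B j ζ ω|‖ₑ ∂P
      ≤ ENNReal.ofReal √(C ^ 2 * (S.1 * S.2) / N) * volume (Set.Icc 0 S) := by
  have := (hB.sheet ⟨0, hN⟩).gaussian.isProbabilityMeasure
  calc ∫⁻ ω, ‖∫ ζ in Set.Icc 0 S, |(1 / (N : ℝ)) * ∑ j, a j * B j ζ ω|‖ₑ ∂P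
      ≤ ∫⁻ ω, (∫⁻ ζ in Set.Icc 0 S, ‖(1 / (N : ℝ)) * ∑ j, a j * B j ζ ω‖ₑ) ∂P := by
        refine lintegral_mono fun ω => (enorm_integral_le_lintegral_enorm _).trans_eq ?_
        simp_rw [← Real.norm_eq_abs, enorm_norm]
    _ = ∫⁻ ζ in Set.Icc 0 S, ∫⁻ ω, ‖(1 / (N : ℝ)) * ∑ j, a j * B j ζ ω‖ₑ ∂P :=
        (lintegral_lintegral_swap
          (f := fun (ζ : ℝ × ℝ) ω => ‖(1 / (N : ℝ)) * ∑ j, a j * B j ζ ω‖ₑ) (hB.aestronglyMeasurable_average a hS).enorm).symm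
    _ ≤ ∫⁻ _ in Set.Icc 0 S, ENNReal.ofReal √(C ^ 2 * (S.1 * S.2) / N) :=
        setLIntegral_mono' measurableSet_Icc fun ζ hζ => hB.lintegral_average_le hN ha hζ
    _ = _ := setLIntegral_const _ _

/-! ### Comparison of the particles with independent copies of the limit -/

/-- If two jointly measurable processes are modifications of each other, then almost surely their
paths agree almost everywhere. -/
lemma ae_ae_eq_of_modification {α β : Type*} [MeasurableSpace α] [MeasurableSpace β]
    {μ : Measure α} {ν : Measure β} [SFinite μ] [SFinite ν] {X Y : α → β → ℝ}
    (hX : AEStronglyMeasurable (fun p : α × β => X p.1 p.2) (μ.prod ν))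
    (hY : AEStronglyMeasurable (fun p : α × β => Y p.1 p.2) (μ.prod ν))
    (h : ∀ᵐ x ∂μ, X x =ᵐ[ν] Y x) : ∀ᵐ y ∂ν, ∀ᵐ x ∂μ, X x y = Y x y := by
  have hprod : ∀ᵐ p ∂μ.prod ν, X p.1 p.2 = Y p.1 p.2 := by
    have h1 : ∀ᵐ p ∂μ.prod ν, hX.mk _ p = hY.mk _ p := by
      rw [Measure.ae_prod_iff_ae_ae (measurableSet_eq_fun hX.stronglyMeasurable_mk.measurable
        hY.stronglyMeasurable_mk.measurable)]
      filter_upwards [h, Measure.ae_ae_of_ae_prod hX.ae_eq_mk,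
        Measure.ae_ae_of_ae_prod hY.ae_eq_mk] with x hx h1 h2
      filter_upwards [hx, h1, h2] with y hy h3 h4
      rw [← h3, ← h4, hy]
    filter_upwards [h1, hX.ae_eq_mk, hY.ae_eq_mk] with p h1 h2 h3
    rw [h2, h3, h1]
  rw [← Measure.prod_swap] at hprod
  exact Measure.ae_ae_of_ae_prod (ae_of_ae_map measurable_swap.aemeasurable hprod)

variable {T y : ℝ} {a : ℕ → ℝ} {Y : Fin N → ℝ × ℝ → Ω → ℝ}

/-- The right-hand side of the particle system, a version of `Yⁱ` with continuous paths. -/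
noncomputable def particleVersion (y : ℝ) (a : ℕ → ℝ) (B Y : Fin N → ℝ × ℝ → Ω → ℝ) (i : Fin N)
    (z : ℝ × ℝ) (ω : Ω) : ℝ :=
  y + (∫ ζ in Set.Icc 0 z, ((1 / (N : ℝ)) * ∑ j : Fin N, a j * Y j ζ ω - Y i ζ ω)) + B i z ω

lemma IsParticleSystem.aestronglyMeasurable_version [SFinite P]
    (hY : IsParticleSystem P T y a B Y) (hB : IsMultiBrownianSheet P B) (i : Fin N) {z : ℝ × ℝ}
    (hz : z ∈ Set.Icc (0 : ℝ × ℝ) (T, T)) :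
    AEStronglyMeasurable (particleVersion y a B Y i z) P := by
  have h1 : AEStronglyMeasurable (fun p : (ℝ × ℝ) × Ω =>
      (1 / (N : ℝ)) * ∑ j : Fin N, a j * Y j p.1 p.2 - Y i p.1 p.2)
      ((volume.restrict (Set.Icc 0 (T, T))).prod P) :=
    ((Finset.aestronglyMeasurable_fun_sum _ fun (j : Fin N) _ =>
      (hY.measurable j).const_mul (a j)).const_mul _).sub (hY.measurable i)
  have h2 := h1.mono_measure (Measure.prod_mono (Measure.restrict_mono
    (Set.Icc_subset_Icc_right hz.2) le_rfl) (le_refl P))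
  exact (aestronglyMeasurable_const.add h2.prod_swap.integral_prod_right').add
    ((hB.sheet i).memLp hz.1).aestronglyMeasurable

lemma IsParticleSystem.ae_eq_version (hY : IsParticleSystem P T y a B Y) (i : Fin N) {z : ℝ × ℝ}
    (hz : z ∈ Set.Icc (0 : ℝ × ℝ) (T, T)) : Y i z =ᵐ[P] particleVersion y a B Y i z :=
  hY.equation i z hz

lemma IsParticleSystem.continuousOn_version (hY : IsParticleSystem P T y a B Y)
    (hB : IsMultiBrownianSheet P B) (i : Fin N) :
    ∀ᵐ ω ∂P, ContinuousOn (fun z => particleVersion y a B Y i z ω) (Set.Icc 0 (T, T)) := by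
  filter_upwards [ae_all_iff.2 hY.integrable_paths, (hB.sheet i).continuous_paths] with ω h1 h2
  refine (continuousOn_const.add (continuousOn_setIntegral_Icc_zero ?_)).add
    (h2.mono Set.Icc_subset_Ici_self)
  exact ((integrable_finsetSum _ fun j _ => (h1 j).const_mul (a j)).const_mul _).sub (h1 i)

/-- Almost surely, the continuous versions solve the particle system simultaneously in all points. -/
lemma IsParticleSystem.version_eq [SFinite P] (hY : IsParticleSystem P T y a B Y)
    (hB : IsMultiBrownianSheet P B) (hT : 0 ≤ T) :
    ∀ᵐ ω ∂P, ∀ i, ∀ z ∈ Set.Icc (0 : ℝ × ℝ) (T, T), particleVersion y a B Y i z ω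
      = y + (∫ ζ in Set.Icc 0 z, ((1 / (N : ℝ)) * ∑ j : Fin N, a j * particleVersion y a B Y j ζ ω
        - particleVersion y a B Y i ζ ω)) + B i z ω := by
  have h : ∀ᵐ ω ∂P, ∀ j, ∀ᵐ ζ ∂volume.restrict (Set.Icc 0 (T, T)),
      Y j ζ ω = particleVersion y a B Y j ζ ω := by
    refine ae_all_iff.2 fun j => ae_ae_eq_of_modification (hY.measurable j)
      (aestronglyMeasurable_of_continuousOn_paths ⟨hT, hT⟩
        (fun z hz => hY.aestronglyMeasurable_version hB j hz) (hY.continuousOn_version hB j)) ?_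
    filter_upwards [ae_restrict_mem measurableSet_Icc] with z hz using hY.ae_eq_version j hz
  filter_upwards [h] with ω hω i z hz
  conv_lhs => rw [particleVersion]
  congr 2
  refine integral_congr_ae ?_
  filter_upwards [ae_all_iff.2 fun j => ae_restrict_of_ae_restrict_of_subset
    (Set.Icc_subset_Icc_right hz.2) (hω j)] with ζ hζ
  simp_rw [hζ]

/-- The constant of `abs_particle_sub_le` on the square `[0,T]²`. -/
noncomputable def particleConst (T C : ℝ) : ℝ :=
  2 * Real.exp (3 * (T + T)) * (1 + 2 * Real.exp ((2 * (C + 1) + 1) * (T + T))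
    * (C + 1) * volume.real (Set.Icc (0 : ℝ × ℝ) (T, T)))

lemma IsParticleSystem.abs_sub_le [SFinite P] (hY : IsParticleSystem P T y a B Y)
    (hB : IsMultiBrownianSheet P B) (hT : 0 ≤ T) {C : ℝ}
    (hC : |(1 / (N : ℝ)) * ∑ j : Fin N, a j| ≤ C) (i : Fin N) {z : ℝ × ℝ}
    (hz : z ∈ Set.Icc (0 : ℝ × ℝ) (T, T)) :
    ∀ᵐ ω ∂P, |Y i z ω - besselF (((1 / (N : ℝ)) * ∑ j : Fin N, a j - 1) * (z.1 * z.2)) * y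
        - goursatResolvent (fun w => B i w ω) z|
      ≤ particleConst T C
        * ∫ ζ in Set.Icc (0 : ℝ × ℝ) (T, T), |(1 / (N : ℝ)) * ∑ j : Fin N, a j * B j ζ ω| := by
  filter_upwards [hY.version_eq hB hT, ae_all_iff.2 (hY.continuousOn_version hB),
    ae_all_iff.2 fun j => (hB.sheet j).continuous_paths, hY.equation i z hz] with ω h1 h2 h3 h4
  rw [h4]
  exact abs_particle_sub_le (a := fun j => a j) (X := fun j ζ => particleVersion y a B Y j ζ ω)
    (b := fun j ζ => B j ζ ω) (S := (T, T)) hC h2 (fun j => (h3 j).mono Set.Icc_subset_Ici_self)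
    h1 i hz

end ParticleSystem

/-! ### Convergence in distribution and the mean-field equation -/

/-- Random variables at vanishing `L¹`-distance from copies of `Z`, possibly on varying probability
spaces, converge to `Z` in distribution. -/
lemma tendstoInDistribution_of_lintegral_sub {Ω : ℕ → Type*} [∀ n, MeasurableSpace (Ω n)]
    {P : (n : ℕ) → Measure (Ω n)} [∀ n, IsProbabilityMeasure (P n)] {Ω' : Type*}
    [MeasurableSpace Ω'] {P' : Measure Ω'} [IsProbabilityMeasure P'] {X W : (n : ℕ) → Ω n → ℝ}
    {Z : Ω' → ℝ} (hX : ∀ n, AEMeasurable (X n) (P n)) (hW : ∀ n, AEMeasurable (W n) (P n))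
    (hZ : AEMeasurable Z P') (hlaw : ∀ n, (P n).map (W n) = P'.map Z)
    (h : Tendsto (fun n => ∫⁻ ω, ‖X n ω - W n ω‖ₑ ∂P n) atTop (𝓝 0)) :
    TendstoInDistribution X atTop Z P P' := by
  refine ⟨hX, hZ, tendsto_iff_forall_lipschitz_integral_tendsto.2 ?_⟩
  rintro F ⟨C, hC⟩ ⟨L, hL⟩
  have hFc : Continuous F := hL.continuous
  simp only [ProbabilityMeasure.coe_mk]
  rw [tendsto_iff_edist_tendsto_0]
  obtain ⟨D, hD⟩ : ∃ D, ∀ x, ‖F x‖ ≤ D := ⟨‖F 0‖ + C, fun x => by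
    have h1 := hC x 0
    have h2 := norm_sub_norm_le (F x) (F 0)
    rw [dist_eq_norm] at h1
    linarith⟩
  have hint : ∀ n {V : Ω n → ℝ}, AEMeasurable V (P n) → Integrable (fun ω => F (V ω)) (P n) :=
    fun n V hV => Integrable.of_bound (hFc.comp_aestronglyMeasurable hV.aestronglyMeasurable) D
      (ae_of_all _ fun ω => hD _)
  have hlim : Tendsto (fun n => (L : ENNReal) * ∫⁻ ω, ‖X n ω - W n ω‖ₑ ∂P n) atTop (𝓝 0) := by
    simpa using ENNReal.Tendsto.const_mul h (Or.inr ENNReal.coe_ne_top)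
  refine tendsto_of_tendsto_of_tendsto_of_le_of_le tendsto_const_nhds hlim (fun _ => zero_le)
    fun n => ?_
  simp only
  rw [← hlaw n, integral_map (hX n) hFc.aestronglyMeasurable,
    integral_map (hW n) hFc.aestronglyMeasurable, edist_eq_enorm_sub,
    ← integral_sub (hint n (hX n)) (hint n (hW n)), ← lintegral_const_mul' _ _ ENNReal.coe_ne_top]
  refine (enorm_integral_le_lintegral_enorm _).trans (lintegral_mono fun ω => ?_)
  rw [← edist_eq_enorm_sub, ← edist_eq_enorm_sub]
  exact hL _ _

/-- The explicit solution of the mean-field equation. -/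
noncomputable def meanFieldProcess {Ω : Type*} (y α : ℝ) (B : ℝ × ℝ → Ω → ℝ) (z : ℝ × ℝ)
    (ω : Ω) : ℝ :=
  besselF ((α - 1) * (z.1 * z.2)) * y + goursatResolvent (fun w => B w ω) z

lemma IsBrownianSheet.isMeanFieldSolution {Ω : Type*} [MeasurableSpace Ω] {P : Measure Ω}
    [IsProbabilityMeasure P] {B : ℝ × ℝ → Ω → ℝ} (hB : IsBrownianSheet P B) {T : ℝ} (hT : 0 ≤ T)
    (y α : ℝ) : IsMeanFieldSolution P T y α B (meanFieldProcess y α B) := by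
  have hcont : ∀ᵐ ω ∂P, ContinuousOn (fun z => meanFieldProcess y α B z ω)
      (Set.Icc 0 (T, T)) := by
    filter_upwards [hB.continuous_paths] with ω hω
    have hf : Continuous fun z : ℝ × ℝ => besselF ((α - 1) * (z.1 * z.2)) * y := by fun_prop
    exact hf.continuousOn.add
      (continuousOn_goursatResolvent (hω.mono Set.Icc_subset_Ici_self))
  have hLp : ∀ z ∈ Set.Icc (0 : ℝ × ℝ) (T, T), MemLp (meanFieldProcess y α B z) 2 P :=
    fun z hz => (memLp_const (besselF ((α - 1) * (z.1 * z.2)) * y)).add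
      (hB.memLp_goursatResolvent hz.1)
  have hmean : ∀ z ∈ Set.Icc (0 : ℝ × ℝ) (T, T), ∫ ω, meanFieldProcess y α B z ω ∂P
      = besselF ((α - 1) * (z.1 * z.2)) * y := by
    intro z hz
    simp only [meanFieldProcess]
    rw [integral_add (integrable_const _) ((hB.memLp_goursatResolvent hz.1).integrable one_le_two),
      hB.integral_goursatResolvent hz.1]
    simp
  refine ⟨?_, hLp, hcont, ?_, ?_⟩
  · exact aestronglyMeasurable_of_continuousOn_paths ⟨hT, hT⟩
      (fun z hz => (hLp z hz).aestronglyMeasurable) hcont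
  · refine IntegrableOn.congr_fun (f := fun z : ℝ × ℝ => besselF ((α - 1) * (z.1 * z.2)) * y) ?_
      (fun z hz => (hmean z hz).symm) measurableSet_Icc
    exact ContinuousOn.integrableOn_compact isCompact_Icc (by fun_prop)
  · filter_upwards [hB.continuous_paths] with ω hω z hz
    have hb : IntegrableOn (fun w => B w ω) (Set.Icc 0 z) :=
      (hω.mono Set.Icc_subset_Ici_self).integrableOn_compact isCompact_Icc
    have h1 : ∫ ζ in Set.Icc 0 z, (α * (∫ ω', meanFieldProcess y α B ζ ω' ∂P)
        - meanFieldProcess y α B ζ ω)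
        = ∫ ζ in Set.Icc 0 z, ((α - 1) * y * besselF ((α - 1) * (ζ.1 * ζ.2))
          - goursatResolvent (fun w => B w ω) ζ) := by
      refine setIntegral_congr_fun measurableSet_Icc fun ζ hζ => ?_
      rw [hmean ζ (Set.Icc_subset_Icc_right hz.2 hζ), meanFieldProcess]
      ring
    have hf : Continuous fun ζ : ℝ × ℝ => (α - 1) * y * besselF ((α - 1) * (ζ.1 * ζ.2)) := by
      fun_prop
    rw [h1, integral_sub (hf.continuousOn.integrableOn_compact isCompact_Icc)
      (integrableOn_goursatResolvent hb), integral_const_mul, meanFieldProcess,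
      goursatResolvent_eq hb, besselF_eq_one_add_integral (α - 1) hz.1]
    ring

theorem mainTheorem3
    (T y α : ℝ) (hT : 0 < T) (hα : 0 < α)
    (a : ℕ → ℝ) (ha_bdd : ∃ C : ℝ, ∀ j, |a j| ≤ C)
    (ha_lim : Tendsto (fun N : ℕ => (1 / (N : ℝ)) * ∑ j : Fin N, a j) atTop (𝓝 α))
    -- for every `N`, a probability space with an `N`-dimensional Brownian sheet `B N`
    -- and a solution `Y N` of the `N`-particle system
    {Ω : ℕ → Type*} [∀ N, MeasurableSpace (Ω N)] (P : (N : ℕ) → Measure (Ω N))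
    [∀ N, IsProbabilityMeasure (P N)]
    (B : (N : ℕ) → Fin N → ℝ × ℝ → Ω N → ℝ) (hB : ∀ N, IsMultiBrownianSheet (P N) (B N))
    (Y : (N : ℕ) → Fin N → ℝ × ℝ → Ω N → ℝ)
    (hY : ∀ N, IsParticleSystem (P N) T y a (B N) (Y N))
    -- a probability space with a Brownian sheet, on which the limit is defined
    {Ω' : Type*} [MeasurableSpace Ω'] (P' : Measure Ω') [IsProbabilityMeasure P']
    (B' : ℝ × ℝ → Ω' → ℝ) (hB' : IsBrownianSheet P' B') :
    ∃ Y' : ℝ × ℝ → Ω' → ℝ,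
      -- `Y'(t,x) = f((α-1)tx) y + ∫₀ᵗ∫₀ˣ f(-(t-u)(x-v)) dB'(u,v)`
      (∀ z ∈ Set.Icc (0 : ℝ × ℝ) (T, T),
        ∃ I : Ω' → ℝ,
          IsWienerIntegral P' B'
            ((Set.Icc 0 z).indicator fun ζ => besselF (-((z.1 - ζ.1) * (z.2 - ζ.2)))) I ∧
          ∀ᵐ ω ∂P', Y' z ω = besselF ((α - 1) * (z.1 * z.2)) * y + I ω) ∧
      -- `Y'` solves the mean-field equation
      IsMeanFieldSolution P' T y α B' Y' ∧
      -- convergence in distribution of the `i`-th particle as the number of particles `N + i + 1`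
      -- tends to infinity
      (∀ i : ℕ, ∀ z ∈ Set.Icc (0 : ℝ × ℝ) (T, T),
        TendstoInDistribution
          (fun N : ℕ => Y (N + i + 1) ⟨i, by omega⟩ z) atTop (Y' z)
          (fun N : ℕ => P (N + i + 1)) P') := by
  obtain ⟨C, hC⟩ := ha_bdd
  refine ⟨meanFieldProcess y α B', fun z hz => ⟨_, hB'.isWienerIntegral_goursatResolvent hz.1,
    ae_of_all _ fun ω => rfl⟩, hB'.isMeanFieldSolution hT.le y α, fun i z hz => ?_⟩
  have hS : (0 : ℝ × ℝ) ≤ (T, T) := ⟨hT.le, hT.le⟩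
  set g : ℝ → ℝ := fun c => besselF ((c - 1) * (z.1 * z.2)) * y with hg
  set ā : ℕ → ℝ := fun N => (1 / (N : ℝ)) * ∑ j : Fin N, a j with hā
  have hā_le : ∀ N, 0 < N → |ā N| ≤ C := by
    intro N hN
    have hN' : (0 : ℝ) < N := by exact_mod_cast hN
    have h1 : |∑ j : Fin N, a j| ≤ N * C := by
      refine (Finset.abs_sum_le_sum_abs _ _).trans ?_
      refine (Finset.sum_le_sum fun (j : Fin N) _ => hC j).trans_eq ?_
      simp
    rw [hā, abs_mul, abs_of_pos (by positivity : 0 < 1 / (N : ℝ)), one_div_mul_eq_div,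
      div_le_iff₀ hN', mul_comm]
    exact h1
  have hVm : ∀ N (k : Fin N), AEMeasurable
      (fun ω => goursatResolvent (fun w => B N k w ω) z) (P N) := fun N k =>
    (((hB N).sheet k).aestronglyMeasurable_goursatResolvent hz.1).aemeasurable
  have hV'm : AEMeasurable (fun ω => goursatResolvent (fun w => B' w ω) z) P' :=
    (hB'.aestronglyMeasurable_goursatResolvent hz.1).aemeasurable
  -- `goursatResolvent (Bⁱ)` on the `N`-th space plus the limiting mean is a copy of the limit
  refine tendstoInDistribution_of_lintegral_sub
    (W := fun N ω => g α + goursatResolvent (fun w => B (N + i + 1) ⟨i, by omega⟩ w ω) z)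
    (fun N => ?_) (fun N => (hVm _ _).const_add _) (hV'm.const_add _) (fun N => ?_) ?_
  · exact (((hY _).aestronglyMeasurable_version (hB _) _ hz).congr
      ((hY _).ae_eq_version _ hz).symm).aemeasurable
  · have hmeas : Measurable fun x : ℝ => g α + x := measurable_const_add _
    have h1 := AEMeasurable.map_map_of_aemeasurable hmeas.aemeasurable
      (hVm (N + i + 1) ⟨i, by omega⟩)
    have h2 := AEMeasurable.map_map_of_aemeasurable hmeas.aemeasurable hV'm
    rw [((hB _).sheet _).map_goursatResolvent_eq hB' hz.1] at h1
    exact h1.symm.trans h2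
  · set K := particleConst T C
    have hbound : ∀ N, ∫⁻ ω, ‖Y (N + i + 1) ⟨i, by omega⟩ z ω
        - (g α + goursatResolvent (fun w => B (N + i + 1) ⟨i, by omega⟩ w ω) z)‖ₑ ∂P (N + i + 1)
        ≤ ‖g (ā (N + i + 1)) - g α‖ₑ + ‖K‖ₑ *
          (ENNReal.ofReal √(C ^ 2 * (T * T) / (N + i + 1 : ℕ))
            * volume (Set.Icc (0 : ℝ × ℝ) (T, T))) := by
      intro N
      set M := N + i + 1 with hM
      have hM0 : 0 < M := by omega
      set β : Ω M → ℝ := fun ω =>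
        ∫ ζ in Set.Icc (0 : ℝ × ℝ) (T, T), |(1 / (M : ℝ)) * ∑ j : Fin M, a j * B M j ζ ω|
      calc _ ≤ ∫⁻ ω, (‖g (ā M) - g α‖ₑ + ‖K‖ₑ * ‖β ω‖ₑ) ∂P M := by
            refine lintegral_mono_ae ?_
            filter_upwards [(hY M).abs_sub_le (hB M) hT.le (hā_le M hM0) ⟨i, by omega⟩ hz]
              with ω hω
            have hsplit : Y M ⟨i, by omega⟩ z ω
                - (g α + goursatResolvent (fun w => B M ⟨i, by omega⟩ w ω) z)
                = (g (ā M) - g α) + (Y M ⟨i, by omega⟩ z ω - g (ā M)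
                  - goursatResolvent (fun w => B M ⟨i, by omega⟩ w ω) z) := by ring
            rw [hsplit, ← enorm_mul]
            refine (enorm_add_le _ _).trans (add_le_add le_rfl ?_)
            rw [Real.enorm_eq_ofReal_abs, Real.enorm_eq_ofReal_abs]
            exact ENNReal.ofReal_le_ofReal (hω.trans (le_abs_self _))
        _ = ‖g (ā M) - g α‖ₑ + ‖K‖ₑ * ∫⁻ ω, ‖β ω‖ₑ ∂P M := by
            rw [lintegral_add_left measurable_const, lintegral_const, measure_univ, mul_one,
              lintegral_const_mul' _ _ enorm_ne_top]
        _ ≤ _ := by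
            gcongr
            exact (hB M).lintegral_integral_average_le hM0 (fun j => hC j) hS
    have hg_cont : Continuous g := by fun_prop
    have hshift : Tendsto (fun N : ℕ => N + i + 1) atTop atTop :=
      (tendsto_add_atTop_nat (i + 1))
    have h1 : Tendsto (fun N => ‖g (ā (N + i + 1)) - g α‖ₑ) atTop (𝓝 0) := by
      have := (((hg_cont.tendsto α).comp (ha_lim.comp hshift)).sub_const (g α)).enorm
      simpa using this
    have h2 : Tendsto (fun N : ℕ => ENNReal.ofReal √(C ^ 2 * (T * T) / (N + i + 1 : ℕ)))
        atTop (𝓝 0) := by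
      have h3 : Tendsto (fun N : ℕ => C ^ 2 * (T * T) / ((N + i + 1 : ℕ) : ℝ)) atTop (𝓝 0) :=
        (tendsto_const_div_atTop_nhds_zero_nat _).comp hshift
      have h4 := (ENNReal.continuous_ofReal.tendsto _).comp
        ((Real.continuous_sqrt.tendsto _).comp h3)
      rwa [Real.sqrt_zero, ENNReal.ofReal_zero] at h4
    have h4 : Tendsto (fun N : ℕ => ‖g (ā (N + i + 1)) - g α‖ₑ + ‖K‖ₑ *
          (ENNReal.ofReal √(C ^ 2 * (T * T) / (N + i + 1 : ℕ))
            * volume (Set.Icc (0 : ℝ × ℝ) (T, T)))) atTop (𝓝 0) := by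
      have h5 := ENNReal.Tendsto.mul_const (b := volume (Set.Icc (0 : ℝ × ℝ) (T, T))) h2
        (Or.inr isCompact_Icc.measure_lt_top.ne)
      have h6 := ENNReal.Tendsto.const_mul (a := ‖K‖ₑ) h5 (Or.inr enorm_ne_top)
      simpa using h1.add h6
    exact tendsto_of_tendsto_of_tendsto_of_le_of_le tendsto_const_nhds h4 (fun _ => zero_le) hbound
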